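/- **The potentials $F_{A_N}$.** For $N\ge 1$ let $\Lambda=\frac{x^{N+1}}{N+1}+y^2+\sum_{k=1}^N v_kx^{k-1}$ be the unfolding of the $A_N$ singularity. The product $\circ$ on the vector fields in $v$ is that of the ring $\mathbb C[v][x,y]/(\partial_x\Lambda,\partial_y\Lambda)$ in the basis $x^{k-1}=\partial\Lambda/\partial v_k$, $1\le k\le N$, and $\eta(\partial_{v_a},\partial_{v_b})$ is the coefficient of $x^{N-1}$ in $\partial_{v_a}\circ\partial_{v_b}$. Give $t_\alpha$ and $v_\alpha$ the weight $N+2-\alpha$. A polynomial $F_{A_N}\in\mathbb C[t_1,\dots,t_N]$ is called a potential of the $A_N$ singularity if there are flat coordinates $t_1,\dots,t_N$, in which the $v_a$ are weighted homogeneous polynomials, $v_a=t_a+O(t^2)$, and $\eta(\partial_{t_\alpha},\partial_{t_\beta})=\delta_{\alpha+\beta,N+1}$, such that $$\frac{\partial}{\partial t_\alpha}\circ\frac{\partial}{\partial t_\beta}=\sum_{\gamma=1}^N\frac{\partial^3F_{A_N}}{\partial t_\alpha\partial t_\beta\partial t_\gamma}\,\frac{\partial}{\partial t_{N+1-\gamma}}$$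 and $F_{A_N}$ is weighted homogeneous of weight $2N+4$. **The hierarchy of type $A$.** For $\alpha,\beta,\gamma_i\ge1$ put, with $N=\alpha+\beta+1$ (and $R=0$ if some $\gamma_i>N$), $$R_{\alpha,\beta;\gamma_1,\dots,\gamma_m}=\frac1{m!}\left.\frac{\partial^{m+2}F_{A_N}}{\partial t_\alpha\,\partial t_\beta\,\partial t_{N+1-\gamma_1}\cdots\partial t_{N+1-\gamma_m}}\right|_{t=0}.$$ Let $K$ be a commutative $\mathbb C$-algebra, consider series $f\in K[[t_1,t_2,\dots]]$, and write $\partial_k=\partial/\partial t_k$. The hierarchy is the system, for all $\alpha,\beta\ge1$, $$(A)_{\alpha\beta}:\qquad \partial_\alpha\partial_\beta f=\sum_{m\ge1}\ \sum_{\gamma_1+\dots+\gamma_m=\alpha+\beta-m}R_{\alpha,\beta;\gamma_1,\dots,\gamma_m}\ \partial_1\partial_{\gamma_1}f\cdots\partial_1\partial_{\gamma_m}f,$$ the sum being over integers $\gamma_i\ge1$. Let $(A')_{\alpha\beta}$ be the equation obtained from $(A)_{\alpha\beta}$ by replacing each $\partial_k$ by $\frac1k\partial_k$. **The KP hierarchies.**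 The dispersionless KP hierarchy is the system, for all $i,j\ge1$, $$\partial_i\partial_jf=\sum_{m\ge1}\frac{(-1)^{m-1}}m\sum_{\gamma_1+\dots+\gamma_m=i+j-m}\frac{ij}{\gamma_1\cdots\gamma_m}\,P_{ij}(\gamma_1,\dots,\gamma_m)\ \partial_1\partial_{\gamma_1}f\cdots\partial_1\partial_{\gamma_m}f,$$ where $P_{ij}(\gamma_1,\dots,\gamma_m)$ is the number of pairs of sequences of positive integers $i_1+\dots+i_m=i$, $j_1+\dots+j_m=j$ with $i_k+j_k=\gamma_k+1$ for all $k$. For $\hbar\in K$ (for instance the formal variable in $K=\mathbb C[[\hbar]]$) put $$D(z)=\sum_{k\ge1}\frac{z^{-k}}k\partial_k,\qquad \Delta(z)=\frac{\exp(\hbar D(z))-1}{\hbar}=\sum_{n\ge1}\frac{\hbar^{n-1}}{n!}D(z)^n=\sum_{k\ge1}\frac{z^{-k}}k\,\partial^\hbar_k ,$$ the last equality being the definition of $\partial_k^\hbar$. The full KP hierarchy for $F=\hbar^2\log\tau\in K[[t_1,t_2,\dots]]$ is the Fay identity of power series in $z_1^{-1},z_2^{-1}$ $$\exp\bigl(\Delta(z_1)\Delta(z_2)F\bigr)=1-\frac{\Delta(z_1)\partial_1F-\Delta(z_2)\partial_1F}{z_1-z_2}.$$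 **Theorem.** For every $N\ge1$ a potential $F_{A_N}$ exists. For any choice of these potentials, any commutative $\mathbb C$-algebra $K$ and any $\hbar\in K$: 1. After the change of variables $t_k\mapsto t_k/k$ the hierarchy $(A)$ coincides with the dispersionless KP hierarchy, equation by equation: for every $f\in K[[t_1,t_2,\dots]]$ and all $\alpha,\beta\ge1$, the series $f(t_1,t_2/2,t_3/3,\dots)$ satisfies $(A)_{\alpha\beta}$ if and only if $f$ satisfies $(A')_{\alpha\beta}$, and if and only if $f$ satisfies the equation of the dispersionless KP hierarchy with $(i,j)=(\alpha,\beta)$. 2. Replacing $\partial_k$ by $\partial_k^\hbar$ in the changed hierarchy $(A')$ gives the full KP hierarchy: $F\in K[[t_1,t_2,\dots]]$ satisfies the Fay identity if and only if, for all $\alpha,\beta\ge1$, it satisfies $(A')_{\alpha\beta}$ with every $\partial_k$ replaced by $\partial_k^\hbar$. -/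

import Mathlib

open scoped BigOperators

noncomputable section

namespace FrobeniusKP

/-! ### The Frobenius potential of the `A_N` singularity

Coordinates are indexed by `Fin N`, starting from zero: the index `a : Fin N` stands for the
coordinate usually numbered `a + 1`.  The involution `α ↦ N + 1 - α` is `Fin.rev`. -/

section Potential

open Polynomial

/-- The miniversal unfolding `x^(N+1)/(N+1) + ∑_{k=1}^N v_k x^(k-1)` of the `A_N` singularity.
(The stabilising summand `y^2` is omitted: its derivative `2y` kills `y` in the Jacobian ring, so
that `A[x,y]/(∂Λ/∂x, ∂Λ/∂y) = A[x]/(Λ')`.) -/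
def unfolding {A : Type*} [CommRing A] [Algebra ℂ A] {N : ℕ} (v : Fin N → A) : A[X] :=
  C (algebraMap ℂ A (1 / ((N : ℂ) + 1))) * X ^ (N + 1) + ∑ k : Fin N, C (v k) * X ^ (k : ℕ)

/-- The normal form, modulo `∂Λ/∂x`, of a polynomial in `x`: it is the coordinate vector in the
basis `1, x, …, x^(N-1)` of the Jacobian ring of the unfolding.  (`∂Λ/∂x` is monic of degree `N`
when `N ≥ 1`.) -/
def jacobiReduce {A : Type*} [CommRing A] [Algebra ℂ A] {N : ℕ} (v : Fin N → A) (p : A[X]) :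
    A[X] :=
  p %ₘ derivative (unfolding v)

/-- The class of the vector field `∂/∂t_α` in the Jacobian ring, for unfolding parameters
`v_a = V_a(t)`: it is `∂Λ/∂t_α = ∑_a (∂V_a/∂t_α) x^(a-1)`. -/
def tangentClass {N : ℕ} (V : Fin N → MvPolynomial (Fin N) ℂ) (α : Fin N) :
    (MvPolynomial (Fin N) ℂ)[X] :=
  ∑ a : Fin N, C (MvPolynomial.pderiv α (V a)) * X ^ (a : ℕ)

/-- The weight of the `α`-th coordinate, multiplied by `N + 1`: in one-based numbering this is
`N + 2 - α`. -/
def weight (N : ℕ) (α : Fin N) : ℕ := N + 1 - (α : ℕ)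

/-- `V` expresses the unfolding parameters `v` of the `A_N` singularity through flat coordinates
`t`, and `F` is the potential of the Frobenius manifold in these coordinates. -/
structure IsFlatPotential (N : ℕ) (V : Fin N → MvPolynomial (Fin N) ℂ)
    (F : MvPolynomial (Fin N) ℂ) : Prop where
  /-- the coordinate change is quasi-homogeneous -/
  coord_homogeneous : ∀ a, MvPolynomial.IsWeightedHomogeneous (weight N) (V a) (weight N a)
  /-- the coordinates are normalised by `v_a = t_a + O(t^2)` -/
  coord_normalized : ∀ a, MvPolynomial.coeff (Finsupp.single a 1) (V a) = 1
  /-- in the coordinates `t` the residue pairing `η(∂_α, ∂_β)`, that is, the coefficient of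
  `x^(N-1)` of the product `∂_α ∘ ∂_β`, is the constant antidiagonal matrix -/
  flat : ∀ α β, (jacobiReduce V (tangentClass V α * tangentClass V β)).coeff (N - 1) =
    if β = Fin.rev α then 1 else 0
  /-- `∂_α ∘ ∂_β = ∑_{γ,δ} (∂_α ∂_β ∂_γ F) η^{γδ} ∂_δ` -/
  product : ∀ α β, jacobiReduce V (tangentClass V α * tangentClass V β) =
    ∑ γ : Fin N,
      C (MvPolynomial.pderiv α (MvPolynomial.pderiv β (MvPolynomial.pderiv γ F))) *
        tangentClass V (Fin.rev γ)
  /-- `E F = (3 - δ) F`, where `(N + 1) (3 - δ) = 2 N + 4` -/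
  potential_homogeneous : MvPolynomial.IsWeightedHomogeneous (weight N) F (2 * N + 4)

/-- `F` is the Frobenius potential `F_{A_N}` of the `A_N` singularity. -/
def IsPotentialA (N : ℕ) (F : MvPolynomial (Fin N) ℂ) : Prop :=
  ∃ V : Fin N → MvPolynomial (Fin N) ℂ, IsFlatPotential N V F

/-- `(1/m!) ∂^(m+2) F / ∂t_α ∂t_β ∂t_{N+1-γ_1} ⋯ ∂t_{N+1-γ_m}` at `t = 0`. -/
def potentialCoeff {N : ℕ} (F : MvPolynomial (Fin N) ℂ) (α β : Fin N) {m : ℕ}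
    (γ : Fin m → Fin N) : ℂ :=
  (1 / (m.factorial : ℂ)) * MvPolynomial.constantCoeff
    ((List.ofFn γ).foldr (fun c G => MvPolynomial.pderiv (Fin.rev c) G)
      (MvPolynomial.pderiv α (MvPolynomial.pderiv β F)))

end Potential

/-- The coefficients `R^A_{α,β;γ_1,…,γ_m}` of the hierarchy built from a series of potentials
`F_N`: they are read off from `F_N` with `N = α + β + 1`.  They vanish if some `γ_i > N`. -/
def coeffR (F : ∀ N : ℕ, MvPolynomial (Fin N) ℂ) (α β : ℕ+) {m : ℕ} (γ : Fin m → ℕ+) : ℂ :=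
  if h : ∀ i, (γ i : ℕ) - 1 < (α : ℕ) + β + 1 then
    potentialCoeff (F ((α : ℕ) + β + 1)) ⟨(α : ℕ) - 1, by omega⟩ ⟨(β : ℕ) - 1, by omega⟩
      (fun i => ⟨(γ i : ℕ) - 1, h i⟩)
  else 0

/-! ### The hierarchy of type `A`

Functions of `t_1, t_2, …` are formal power series over a commutative `ℂ`-algebra `K`. -/

/-- All tuples of integers `γ_1, …, γ_m ≥ 1` with `γ_1 + ⋯ + γ_m = s - m`. -/
def tuples (s : ℕ+) (m : ℕ) : Finset (Fin m → ℕ+) :=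
  (Fintype.piFinset fun _ : Fin m => Finset.Icc 1 s).filter
    fun γ => (∑ i, (γ i : ℕ)) + m = s

section Hierarchies

variable {K : Type*} [CommRing K] [Algebra ℂ K]

/-- The partial derivative `∂_k = ∂/∂t_k`. -/
def partialD (K : Type*) [CommRing K] (k : ℕ+) : Module.End K (MvPowerSeries ℕ+ K) :=
  (MvPowerSeries.pderiv K k).toLinearMap

/-- The equation with indices `(α, β)` of the hierarchy built from the potentials `F_N`,
`∂_α ∂_β f = ∑_{m ≥ 1} ∑_{γ_1+⋯+γ_m = α+β-m} R^A_{α,β;γ_1,…,γ_m} ∏_i ∂_1 ∂_{γ_i} f`,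
with a given family of operators `d k` in the place of `∂_k`. -/
def EquationA (F : ∀ N : ℕ, MvPolynomial (Fin N) ℂ)
    (d : ℕ+ → Module.End K (MvPowerSeries ℕ+ K)) (α β : ℕ+) (f : MvPowerSeries ℕ+ K) : Prop :=
  d α (d β f) = ∑ m ∈ Finset.Icc 1 ((α : ℕ) + β), ∑ γ ∈ tuples (α + β) m,
    coeffR F α β γ • ∏ i, d 1 (d (γ i) f)

/-- The same equation after the change of variables `t_k ↦ t_k / k`, which replaces `∂_k` by
`(1/k) ∂_k`; here again operators `d k` may stand in the place of `∂_k`. -/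
def EquationARescaled (F : ∀ N : ℕ, MvPolynomial (Fin N) ℂ)
    (d : ℕ+ → Module.End K (MvPowerSeries ℕ+ K)) (α β : ℕ+) (f : MvPowerSeries ℕ+ K) : Prop :=
  EquationA F (fun k => algebraMap ℂ K (1 / ((k : ℕ) : ℂ)) • d k) α β f

/-- The change of variables `t_k ↦ t_k / k`: the series `f (t_1, t_2 / 2, t_3 / 3, …)`. -/
def changeVars (f : MvPowerSeries ℕ+ K) : MvPowerSeries ℕ+ K :=
  MvPowerSeries.rescale (fun k : ℕ+ => algebraMap ℂ K (1 / ((k : ℕ) : ℂ))) f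

/-! ### The dispersionless KP hierarchy -/

/-- The number of pairs of sequences of positive integers `i_1, …, i_m` with sum `i` and
`j_1, …, j_m` with sum `j` such that `i_k + j_k = γ_k + 1` for all `k`. -/
def partitionCount (i j : ℕ+) {m : ℕ} (γ : Fin m → ℕ+) : ℕ :=
  Nat.card {p : (Fin m → ℕ+) × (Fin m → ℕ+) //
    ∑ k, (p.1 k : ℕ) = i ∧ ∑ k, (p.2 k : ℕ) = j ∧ ∀ k, p.1 k + p.2 k = γ k + 1}

/-- The equation with indices `(i, j)` of the dispersionless KP hierarchy. -/
def EquationDKP (i j : ℕ+) (f : MvPowerSeries ℕ+ K) : Prop :=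
  partialD K i (partialD K j f) =
    ∑ m ∈ Finset.Icc 1 ((i : ℕ) + j), ∑ γ ∈ tuples (i + j) m,
      ((-1 : ℂ) ^ (m - 1) / (m : ℂ) * ((i : ℕ) * (j : ℕ) / ∏ k, ((γ k : ℕ) : ℂ)) *
          (partitionCount i j γ : ℂ)) •
        ∏ k, partialD K 1 (partialD K (γ k) f)

/-! ### The full KP hierarchy

`w = z⁻¹` is the variable of the power series below. -/

/-- `D(z) = ∑_{k ≥ 1} (z^(-k)/k) ∂_k`, a power series in `z⁻¹` whose coefficients are operators. -/
def opD (K : Type*) [CommRing K] [Algebra ℂ K] :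
    PowerSeries (Module.End K (MvPowerSeries ℕ+ K)) :=
  PowerSeries.mk fun k =>
    if h : 0 < k then algebraMap ℂ K (1 / (k : ℂ)) • partialD K ⟨k, h⟩ else 0

/-- The coefficient of `z^(-n)` in `Δ(z) = (exp(ħ D(z)) - 1)/ħ = ∑_{m ≥ 1} (ħ^(m-1)/m!) D(z)^m`.
Only `m ≤ n` contribute, because `D(z)` has no constant term. -/
def opDelta (h : K) (n : ℕ) : Module.End K (MvPowerSeries ℕ+ K) :=
  ∑ m ∈ Finset.Icc 1 n,
    (algebraMap ℂ K (1 / (m.factorial : ℂ)) * h ^ (m - 1)) • PowerSeries.coeff n (opD K ^ m)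

/-- The operators `∂_k^ħ`, defined by `Δ(z) = ∑_{k ≥ 1} (z^(-k)/k) ∂_k^ħ`. -/
def partialH (h : K) (k : ℕ+) : Module.End K (MvPowerSeries ℕ+ K) :=
  algebraMap ℂ K ((k : ℕ) : ℂ) • opDelta h k

/-- `Δ(z_j) g` as a power series in `z_1⁻¹, z_2⁻¹` (`j = 0` for `z_1` and `j = 1` for `z_2`). -/
def deltaSeries (h : K) (j : Fin 2) (g : MvPowerSeries ℕ+ K) :
    MvPowerSeries (Fin 2) (MvPowerSeries ℕ+ K) :=
  fun n => if n = Finsupp.single j (n j) then opDelta h (n j) g else 0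

/-- `Δ(z_1) Δ(z_2) F` as a power series in `z_1⁻¹, z_2⁻¹`. -/
def deltaDeltaSeries (h : K) (F : MvPowerSeries ℕ+ K) :
    MvPowerSeries (Fin 2) (MvPowerSeries ℕ+ K) :=
  fun n => opDelta h (n 0) (opDelta h (n 1) F)

/-- The full KP hierarchy for `F = ħ² log τ`, in the form of the Fay identity
`exp(Δ(z_1) Δ(z_2) F) = 1 - (Δ(z_1) ∂_1 F - Δ(z_2) ∂_1 F)/(z_1 - z_2)`
between power series in `w_1 = z_1⁻¹` and `w_2 = z_2⁻¹`.  Both sides are multiplied by the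
non-zero-divisor `w_1 w_2 (z_1 - z_2) = w_2 - w_1`. -/
def IsKPSolution (h : K) (F : MvPowerSeries ℕ+ K) : Prop :=
  letI w : Fin 2 → MvPowerSeries (Fin 2) (MvPowerSeries ℕ+ K) := fun j => MvPowerSeries.X j
  (w 1 - w 0) * (PowerSeries.exp ℂ).subst (deltaDeltaSeries h F) =
    (w 1 - w 0) - w 0 * w 1 *
      (deltaSeries h 0 (partialD K 1 F) - deltaSeries h 1 (partialD K 1 F))

end Hierarchies

end FrobeniusKP

end

/-! Everything rests on one generating series. For $x(z)=z-\sum_k T_kz^{-k-1}$ expand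
$G(z)=1/(x(z)-x)=\sum_n\varphi_n(x)z^{-n}$. When the $T_k$ are the flat coordinates in reverse order
(`flatTime`), the Faber polynomials $\varphi_1,\dots,\varphi_N$ are the classes
$\partial\Lambda/\partial t_\alpha$ and $\varphi_{N+1}=\partial\Lambda/\partial x$; $\Lambda$ itself
is recovered from them by Euler's identity (`flatUnfolding`).

Existence and uniqueness. The recurrence for $\varphi_n$ makes the residue pairing antidiagonal and
gives the quotient of $\varphi_a\varphi_b$ by $\varphi_{N+1}$ as another Faber polynomial. Comparing
two computations of the quotient of a triple product yields the integrability of the structure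
constants (`pderiv_flatConst`), and homogeneity integrates them to a potential. Conversely, an
isometry between flat coordinate systems is affine, so weights and normalisation determine the flat
coordinates, and all potentials have the same third derivatives
(`IsPotentialA.pderiv_eq_flatConst`).

The coefficients. Put $1+P=(x(z_1)-x(z_2))/(z_1-z_2)$ and $w_i=z_i^{-1}$. From
$(x(z_1)-x(z_2))G(z_1)G(z_2)=G(z_2)-G(z_1)$ one gets
$(1+P)\,G(z_1)G(z_2)=\sum_{i,j\ge1}\varphi_{i+j-1}w_1^iw_2^j$ (`faber_mul_faber`), and in low degree
the right-hand side is $\sum_c\varphi_{N+1-c}\,\partial_cP$. So $\varphi_i\varphi_j$ has the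
coordinates $\partial_c[\log(1+P)]_{ij}$. For $N=\alpha+\beta+1$ the product
$\varphi_\alpha\varphi_\beta$ needs no reduction modulo $\varphi_{N+1}$, hence
$\partial_\alpha\partial_\beta F_{A_N}$ and $[\log(1+P)]_{\alpha\beta}$ have the same gradient. As
$P$ is linear in $t$, the Taylor coefficients are $\frac{(-1)^{m-1}}m P_{\alpha\beta}(\gamma)$
(`coeffR_eq`).

The hierarchies. For any operators $d_k$, equation $(A)_{\alpha\beta}$ therefore says that $d_\alpha
d_\beta f$ is the coefficient of $w_1^\alpha w_2^\beta$ in $\log\bigl(1+\sum_\gamma d_1d_\gamma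
f\sum_{i+j=\gamma+1}w_1^iw_2^j\bigr)$ (`equationA_iff`). For $d_k=\frac1k\partial_k$ this is
dispersionless KP; for $d_k=\frac1k\partial_k^\hbar$ it is the logarithm of the Fay identity. -/

noncomputable section

namespace FrobeniusKP

/-! ### Faber polynomials

For `x(z) = z - ∑_k T_k z^(-k-1)` these are the coefficients of
`1 / (x(z) - x) = ∑_n faber T n * z^(-n)`. -/

section Faber

open Polynomial Finset

variable {A : Type*} [CommRing A]

/-- The polynomials `φ_n` in `x` with `1 / (x(z) - x) = ∑_n φ_n z^(-n)`, where
`x(z) = z - ∑_k T_k z^(-k-1)`. -/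
def faber (T : ℕ → A) : ℕ → A[X]
  | 0 => 0
  | 1 => 1
  | n + 2 => X * faber T (n + 1) + ∑ k ∈ range (n + 1), C (T k) * faber T (n - k)
termination_by n => n

@[simp] lemma faber_zero (T : ℕ → A) : faber T 0 = 0 := by rw [faber]

@[simp] lemma faber_one (T : ℕ → A) : faber T 1 = 1 := by rw [faber]

lemma faber_add_two (T : ℕ → A) (n : ℕ) :
    faber T (n + 2) = X * faber T (n + 1) + ∑ k ∈ range (n + 1), C (T k) * faber T (n - k) := by
  rw [faber]

/-- Truncated subtraction together with $\varphi_0=0$ kills every term with `k ≥ n`, so the upper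
limit of the sum is immaterial from `n` on. -/
lemma faber_add_two_of_le (T : ℕ → A) {n M : ℕ} (h : n ≤ M) :
    faber T (n + 2) = X * faber T (n + 1) + ∑ k ∈ range M, C (T k) * faber T (n - k) := by
  rw [faber_add_two]
  congr 1
  have h0 : ∀ m, n ≤ m → ∑ k ∈ range m, C (T k) * faber T (n - k) =
      ∑ k ∈ range n, C (T k) * faber T (n - k) := by
    intro m hm
    refine (sum_subset (range_subset_range.2 hm) fun k _ hk => ?_).symm
    rw [Finset.mem_range, not_lt] at hk
    rw [Nat.sub_eq_zero_of_le hk, faber_zero, mul_zero]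
  rw [h0 (n + 1) (Nat.le_succ n), h0 M h]

lemma map_faber {B : Type*} [CommRing B] (σ : A →+* B) (T : ℕ → A) (n : ℕ) :
    (faber T n).map σ = faber (fun k => σ (T k)) n := by
  induction n using Nat.strong_induction_on with
  | _ n ih =>
    match n with
    | 0 => simp
    | 1 => simp
    | n + 2 =>
      rw [faber_add_two, faber_add_two, Polynomial.map_add, Polynomial.map_mul, map_X,
        Polynomial.map_sum, ih (n + 1) (by omega)]
      congr 1
      refine sum_congr rfl fun k _ => ?_
      rw [Polynomial.map_mul, map_C, ih (n - k) (by omega)]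

lemma coeff_faber_of_le (T : ℕ → A) {n k : ℕ} (h : n ≤ k) : (faber T n).coeff k = 0 := by
  induction n using Nat.strong_induction_on generalizing k with
  | _ n ih =>
    match n with
    | 0 => simp
    | 1 => rw [faber_one, coeff_one, if_neg (by omega)]
    | n + 2 =>
      obtain ⟨k, rfl⟩ : ∃ l, k = l + 1 := ⟨k - 1, by omega⟩
      rw [faber_add_two, coeff_add, coeff_X_mul, ih (n + 1) (by omega) (by omega), finsetSum_coeff,
        sum_eq_zero, add_zero]
      intro j _
      rw [coeff_C_mul, ih (n - j) (by omega) (by omega), mul_zero]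

lemma coeff_faber_add_two_succ (T : ℕ → A) {n k : ℕ} (h : n ≤ k) :
    (faber T (n + 2)).coeff (k + 1) = (faber T (n + 1)).coeff k := by
  rw [faber_add_two, coeff_add, coeff_X_mul, finsetSum_coeff, sum_eq_zero, add_zero]
  intro j _
  rw [coeff_C_mul, coeff_faber_of_le _ (by omega), mul_zero]

lemma coeff_faber_succ_self (T : ℕ → A) (n : ℕ) : (faber T (n + 1)).coeff n = 1 := by
  induction n with
  | zero => simp
  | succ n ih => rw [coeff_faber_add_two_succ _ le_rfl, ih]

/-- The subleading coefficient vanishes because $x(z)$ has no $z^0$ term. This is why the unfolding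
has no $x^N$ term. -/
lemma coeff_faber_add_two_self (T : ℕ → A) (n : ℕ) : (faber T (n + 2)).coeff n = 0 := by
  induction n with
  | zero => simp [faber_add_two]
  | succ n ih =>
    rw [faber_add_two, coeff_add, coeff_X_mul, ih, finsetSum_coeff, sum_eq_zero, add_zero]
    intro j _
    rw [coeff_C_mul, coeff_faber_of_le _ (by omega), mul_zero]

lemma degree_faber_lt (T : ℕ → A) (n : ℕ) : (faber T n).degree < n :=
  (degree_lt_iff_coeff_zero _ _).2 fun _ hk => coeff_faber_of_le T hk

lemma degree_faber_succ_le (T : ℕ → A) (n : ℕ) : (faber T (n + 1)).degree ≤ n :=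
  (degree_le_iff_coeff_zero _ _).2 fun _ hk => coeff_faber_of_le T (by exact_mod_cast hk)

lemma monic_faber_succ (T : ℕ → A) (n : ℕ) : (faber T (n + 1)).Monic :=
  monic_of_degree_le n (degree_faber_succ_le T n) (coeff_faber_succ_self T n)

lemma degree_faber_succ [Nontrivial A] (T : ℕ → A) (n : ℕ) : (faber T (n + 1)).degree = n := by
  refine le_antisymm (degree_faber_succ_le T n) ?_
  exact le_degree_of_ne_zero (by rw [coeff_faber_succ_self]; exact one_ne_zero)

/-- In generating form: $\partial G/\partial T_k=z^{-k-1}G^2=z^{-k-1}\,\partial G/\partial x$. -/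
lemma faber_derivation_eq_derivative {R : Type*} [CommRing R] [Algebra R A]
    (D : Derivation R A[X] A[X]) (T : ℕ → A) (k : ℕ) (hX : D X = 0)
    (hT : ∀ j, D (C (T j)) = if j = k then 1 else 0) (n : ℕ) :
    D (faber T n) = derivative (faber T (n - (k + 1))) := by
  induction n using Nat.strong_induction_on with
  | _ n ih =>
    match n with
    | 0 => simp
    | 1 => simp
    | n + 2 =>
      have h1 : D (faber T (n + 2)) = X * derivative (faber T (n - k)) +
          ∑ j ∈ range (n + 1), C (T j) * derivative (faber T (n - j - (k + 1))) +
          faber T (n - k) := by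
        rw [faber_add_two, map_add, D.leibniz, hX, ih (n + 1) (by omega), map_sum,
          Nat.add_sub_add_right, smul_zero, add_zero, smul_eq_mul, add_assoc]
        congr 1
        have : ∀ j ∈ range (n + 1), D (C (T j) * faber T (n - j)) =
            C (T j) * derivative (faber T (n - j - (k + 1))) +
              if j = k then faber T (n - j) else 0 := by
          intro j _
          rw [D.leibniz, ih (n - j) (by omega), hT, smul_eq_mul, smul_eq_mul, mul_ite, mul_one,
            mul_zero]
        rw [sum_congr rfl this, sum_add_distrib, sum_ite_eq']
        congr 1
        split_ifs with hk
        · rfl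
        · rw [Finset.mem_range] at hk
          rw [Nat.sub_eq_zero_of_le (by omega), faber_zero]
      rw [h1]
      rcases Nat.lt_or_ge k n with hk | hk
      · obtain ⟨m, rfl⟩ : ∃ m, n = m + k + 1 := ⟨n - k - 1, by omega⟩
        have h2 : ∀ j, m + k + 1 - j - (k + 1) = m - j := by omega
        rw [show m + k + 1 - k = m + 1 by omega, show m + k + 1 + 2 - (k + 1) = m + 2 by omega,
          faber_add_two_of_le T (show m ≤ m + k + 1 + 1 by omega), derivative_add, derivative_mul,
          derivative_X, one_mul, derivative_sum]
        simp only [h2, derivative_mul, derivative_C, zero_mul, zero_add]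
        ring
      · have h0 : ∀ j, faber T (n - j - (k + 1)) = 0 := fun j => by
          rw [Nat.sub_eq_zero_of_le (by omega), faber_zero]
        simp only [Nat.sub_eq_zero_of_le hk, h0, faber_zero, derivative_zero, mul_zero,
          sum_const_zero, add_zero]
        rcases (show n + 2 - (k + 1) = 0 ∨ n + 2 - (k + 1) = 1 by omega) with h | h <;> simp [h]

/-- With $x$ and $z$ of weight $1$ and $T_j$ of weight $j+2$, the series $x(z)$ is homogeneous and
$G$ has weight $-1$. -/
lemma faber_euler {R : Type*} [CommRing R] [Algebra R A]
    (D : Derivation R A[X] A[X]) (T : ℕ → A) (hX : D X = X)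
    (hT : ∀ j, D (C (T j)) = ((j : A[X]) + 2) * C (T j)) (n : ℕ) :
    D (faber T n) = ((n : A[X]) - 1) * faber T n := by
  induction n using Nat.strong_induction_on with
  | _ n ih =>
    match n with
    | 0 => simp
    | 1 => simp
    | n + 2 =>
      rw [faber_add_two, map_add, D.leibniz, hX, ih (n + 1) (by omega), map_sum, mul_add, mul_sum,
        smul_eq_mul, smul_eq_mul]
      congr 1
      · push_cast; ring
      · refine sum_congr rfl fun j hj => ?_
        rw [D.leibniz, ih (n - j) (by omega), hT, smul_eq_mul, smul_eq_mul,
          Nat.cast_sub (Nat.lt_succ_iff.1 (Finset.mem_range.1 hj))]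
        push_cast; ring

/-- Eliminates $x$ between two instances of the recurrence, so that a unit of index can be moved
from one factor to the other. -/
lemma faber_succ_mul_faber (T : ℕ → A) (i j : ℕ) :
    faber T (i + 2) * faber T (j + 1) + faber T (i + 1) * ∑ k ∈ range (j + 1),
        C (T k) * faber T (j - k) =
      faber T (i + 1) * faber T (j + 2) + (∑ k ∈ range (i + 1), C (T k) * faber T (i - k)) *
        faber T (j + 1) := by
  rw [faber_add_two, faber_add_two]
  ring

/-- The coefficients of `(x(z₁) - x(z₂)) / (z₁ - z₂) · G(z₁) G(z₂) = (G(z₂) - G(z₁)) / (z₁ - z₂)`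
with `G(z) = 1 / (x(z) - x)`. -/
lemma faber_mul_faber (T : ℕ → A) (i j : ℕ) :
    faber T (i + 1) * faber T (j + 1) + ∑ a ∈ range (i + 1), ∑ b ∈ range (j + 1),
      C (T (a + b)) * (faber T (i - a) * faber T (j - b)) = faber T (i + j + 1) := by
  induction i generalizing j with
  | zero => simp
  | succ i ih =>
    have h := ih (j + 1)
    have h2 := faber_succ_mul_faber T i j
    have e1 : ∑ a ∈ range (i + 1 + 1), ∑ b ∈ range (j + 1),
        C (T (a + b)) * (faber T (i + 1 - a) * faber T (j - b)) =
        (∑ a ∈ range (i + 1), ∑ b ∈ range (j + 1),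
          C (T (a + b + 1)) * (faber T (i - a) * faber T (j - b))) +
        faber T (i + 1) * ∑ k ∈ range (j + 1), C (T k) * faber T (j - k) := by
      rw [sum_range_succ', mul_sum]
      congr 1
      · refine sum_congr rfl fun a _ => sum_congr rfl fun b _ => ?_
        rw [Nat.add_sub_add_right, show a + 1 + b = a + b + 1 by omega]
      · refine sum_congr rfl fun b _ => ?_
        rw [Nat.zero_add, Nat.sub_zero]; ring
    have e2 : ∑ a ∈ range (i + 1), ∑ b ∈ range (j + 1 + 1),
        C (T (a + b)) * (faber T (i - a) * faber T (j + 1 - b)) =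
        (∑ a ∈ range (i + 1), ∑ b ∈ range (j + 1),
          C (T (a + b + 1)) * (faber T (i - a) * faber T (j - b))) +
        (∑ k ∈ range (i + 1), C (T k) * faber T (i - k)) * faber T (j + 1) := by
      rw [sum_mul, ← sum_add_distrib]
      refine sum_congr rfl fun a _ => ?_
      rw [sum_range_succ']
      congr 1
      · refine sum_congr rfl fun b _ => ?_
        rw [Nat.add_sub_add_right, show a + (b + 1) = a + b + 1 by omega]
      · rw [Nat.add_zero, Nat.sub_zero]; ring
    rw [e2, show i + (j + 1) + 1 = i + 1 + j + 1 by omega] at h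
    rw [e1, ← h]
    linear_combination h2

/-- A linear functional on products of Faber polynomials is determined by its values on the
products with `φ_1 = 1` and with `φ_(N+1)`. -/
lemma map_faber_mul_faber {M : Type*} [AddCommGroup M] [Module A M] (T : ℕ → A) (N : ℕ)
    (l : A[X] →ₗ[A] M) (f : ℕ → M) (hf : ∀ n < N, f n = 0)
    (h1 : ∀ b ≤ N, l (faber T b) = f b)
    (h2 : ∀ a < N, l (faber T (a + 1) * faber T (N + 1)) = f (N + a + 1))
    (a b : ℕ) (ha : a < N) (hb : b ≤ N) :
    l (faber T (a + 1) * faber T (b + 1)) = f (a + b + 1) := by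
  induction a using Nat.strong_induction_on generalizing b with
  | _ a ih =>
    match a with
    | 0 =>
      rcases hb.eq_or_lt with rfl | hb
      · rw [h2 0 ha, Nat.zero_add, Nat.add_zero]
      · rw [faber_one, one_mul, h1 _ (by omega), Nat.zero_add]
    | a + 1 =>
      rcases hb.eq_or_lt with rfl | hb
      · rw [h2 _ ha, add_comm b]
      -- Moving one unit of index from the first factor to the second costs two correction sums; by
      -- induction both have the terms $T_k f(a+b-k)$ and cancel.
      have h := congrArg l (faber_succ_mul_faber T a b)
      rw [map_add, map_add, ih a (by omega) (b + 1) (by omega) (by omega), mul_sum, sum_mul, map_sum,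
        map_sum] at h
      have e1 : ∀ k, l (faber T (a + 1) * (C (T k) * faber T (b - k))) =
          T k • f (a + b - k) := by
        intro k
        rw [mul_left_comm, ← smul_eq_C_mul, map_smul]
        congr 1
        rcases Nat.lt_or_ge k b with hk | hk
        · obtain ⟨c, hc⟩ : ∃ c, b - k = c + 1 := ⟨b - k - 1, by omega⟩
          rw [hc, ih a (by omega) _ (by omega) (by omega)]
          congr 1; omega
        · rw [Nat.sub_eq_zero_of_le hk, faber_zero, mul_zero, map_zero, hf _ (by omega)]
      have e2 : ∀ k, l (C (T k) * faber T (a - k) * faber T (b + 1)) =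
          T k • f (a + b - k) := by
        intro k
        rw [mul_assoc, ← smul_eq_C_mul, map_smul]
        congr 1
        rcases Nat.lt_or_ge k a with hk | hk
        · obtain ⟨c, hc⟩ : ∃ c, a - k = c + 1 := ⟨a - k - 1, by omega⟩
          rw [hc, ih c (by omega) _ (by omega) (by omega)]
          congr 1; omega
        · rw [Nat.sub_eq_zero_of_le hk, faber_zero, zero_mul, map_zero, hf _ (by omega)]
      simp only [e1, e2] at h
      -- For $k\ge\min(a,b)$ the index $a+b-k$ is at most $\max(a,b)<N$, where $f$ vanishes; so the
      -- two sums agree despite their different ranges.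
      have e3 : ∀ m, a ≤ m ∨ b ≤ m → ∀ m', m ≤ m' → (∑ k ∈ range (m' + 1), T k • f (a + b - k)) =
          ∑ k ∈ range m, T k • f (a + b - k) := by
        intro m hm m' hmm
        refine (sum_subset (range_subset_range.2 (by omega)) fun k _ hk => ?_).symm
        rw [Finset.mem_range, not_lt] at hk
        rw [hf _ (by omega), smul_zero]
      rw [e3 (min a b) (by omega) a (by omega), e3 (min a b) (by omega) b (by omega)] at h
      rw [show a + 1 + b + 1 = a + (b + 1) + 1 by omega]
      exact add_right_cancel h

end Faber

/-! ### Derivations of polynomial rings -/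

section Derivations

open Polynomial Finset

variable {R A : Type*} [CommRing R] [CommRing A] [Algebra R A]

/-- The derivation of `A[X]` that acts on the coefficients. -/
def coeffDerivation (d : Derivation R A A) : Derivation R A[X] A[X] :=
  (PolynomialModule.equivPolynomialSelf (R := A)).toLinearMap.compDer d.mapCoeffs

lemma coeff_coeffDerivation (d : Derivation R A A) (p : A[X]) (n : ℕ) :
    (coeffDerivation d p).coeff n = d (p.coeff n) := rfl

@[simp] lemma coeffDerivation_X (d : Derivation R A A) : coeffDerivation d X = 0 := by
  ext n
  rw [coeff_coeffDerivation, coeff_X, apply_ite d, map_zero, d.map_one_eq_zero, ite_self,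
    coeff_zero]

@[simp] lemma coeffDerivation_C (d : Derivation R A A) (a : A) :
    coeffDerivation d (C a) = C (d a) := by
  ext n
  rw [coeff_coeffDerivation, coeff_C, coeff_C, apply_ite d, map_zero]

/-- The derivation `d + x ∂/∂x` of `A[X]`. -/
def gradedDerivation (d : Derivation R A A) : Derivation R A[X] A[X] :=
  coeffDerivation d + (X : A[X]) • (derivative' (R := A)).restrictScalars R

lemma gradedDerivation_apply (d : Derivation R A A) (p : A[X]) :
    gradedDerivation d p = coeffDerivation d p + X * derivative p := rfl

lemma coeff_gradedDerivation (d : Derivation R A A) (p : A[X]) (n : ℕ) :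
    (gradedDerivation d p).coeff n = d (p.coeff n) + n * p.coeff n := by
  rw [gradedDerivation_apply, coeff_add, coeff_coeffDerivation]
  cases n with
  | zero => simp
  | succ n => rw [coeff_X_mul, coeff_derivative]; push_cast; ring

@[simp] lemma gradedDerivation_C (d : Derivation R A A) (a : A) :
    gradedDerivation d (C a) = C (d a) := by
  rw [gradedDerivation_apply, coeffDerivation_C, derivative_C, mul_zero, add_zero]

@[simp] lemma gradedDerivation_X (d : Derivation R A A) : gradedDerivation d X = X := by
  rw [gradedDerivation_apply, coeffDerivation_X, derivative_X, mul_one, zero_add]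

end Derivations

/-! ### The residue form of the `A_N` singularity -/

section Residue

open Polynomial Finset

variable {A : Type*} [CommRing A]

/-- Quotients by a polynomial as a linear map. -/
def divByMonicLin {P : A[X]} (hP : P.Monic) : A[X] →ₗ[A] A[X] where
  toFun p := p /ₘ P
  map_add' p q := by
    nontriviality A
    refine (div_modByMonic_unique (p /ₘ P + q /ₘ P) (p %ₘ P + q %ₘ P) hP ⟨?_, ?_⟩).1
    · linear_combination modByMonic_add_div p P + modByMonic_add_div q P
    · exact (degree_add_le _ _).trans_lt
        (max_lt (degree_modByMonic_lt _ hP) (degree_modByMonic_lt _ hP))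
  map_smul' a p := by
    nontriviality A
    refine (div_modByMonic_unique (a • (p /ₘ P)) (a • (p %ₘ P)) hP ⟨?_, ?_⟩).1
    · rw [mul_smul_comm, ← smul_add, modByMonic_add_div p P]
    · exact (degree_smul_le _ _).trans_lt (degree_modByMonic_lt _ hP)

lemma divByMonicLin_apply {P : A[X]} (hP : P.Monic) (p : A[X]) : divByMonicLin hP p = p /ₘ P := rfl

/-- The coefficient of `x^(N-1)` of the normal form modulo `φ_(N+1)`. -/
def residueForm (T : ℕ → A) (N : ℕ) : A[X] →ₗ[A] A :=
  lcoeff A (N - 1) ∘ₗ modByMonicHom (faber T (N + 1))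

lemma residueForm_apply (T : ℕ → A) (N : ℕ) (p : A[X]) :
    residueForm T N p = (p %ₘ faber T (N + 1)).coeff (N - 1) := rfl

variable (T : ℕ → A) {N : ℕ}

lemma degree_faber_lt_of_le {b : ℕ} (hb : b ≤ N) : (faber T b).degree < N :=
  (degree_faber_lt T b).trans_le (by exact_mod_cast hb)

lemma degree_faber_sum_lt (e : Fin N → A) :
    (∑ c : Fin N, C (e c) * faber T (Fin.rev c + 1)).degree < N := by
  refine (degree_sum_le _ _).trans_lt ((Finset.sup_lt_iff (WithBot.bot_lt_coe N)).2 fun c _ => ?_)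
  rw [← smul_eq_C_mul]
  exact (degree_smul_le _ _).trans_lt (degree_faber_lt_of_le T (Fin.is_lt _))

lemma residueForm_modByMonic_mul (p q : A[X]) :
    residueForm T N ((p %ₘ faber T (N + 1)) * q) = residueForm T N (p * q) := by
  rw [residueForm_apply, residueForm_apply]
  congr 1
  refine modByMonic_eq_of_dvd_sub (monic_faber_succ T N) ?_
  rw [← sub_mul]
  exact Dvd.dvd.mul_right (dvd_modByMonic_sub p _) q

/-- The structure constants `η(∂_a ∘ ∂_b, ∂_c)`. -/
def structureConst (N : ℕ) (a b c : Fin N) : A :=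
  residueForm T N (faber T (a + 1) * faber T (b + 1) * faber T (c + 1))

lemma structureConst_swap_left (a b c : Fin N) :
    structureConst T N a b c = structureConst T N b a c := by
  rw [structureConst, structureConst, mul_comm (faber T (a + 1))]

lemma structureConst_swap_right (a b c : Fin N) :
    structureConst T N a b c = structureConst T N a c b := by
  rw [structureConst, structureConst, mul_right_comm]

variable [Nontrivial A]

lemma modByMonic_faber_of_degree_lt {p : A[X]} (hp : p.degree < N) :
    p %ₘ faber T (N + 1) = p :=
  (modByMonic_eq_self_iff (monic_faber_succ T N)).2 (by rwa [degree_faber_succ])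

lemma degree_modByMonic_faber_lt (p : A[X]) : (p %ₘ faber T (N + 1)).degree < N := by
  simpa only [degree_faber_succ] using degree_modByMonic_lt p (monic_faber_succ T N)

lemma residueForm_of_degree_lt {p : A[X]} (hp : p.degree < N) :
    residueForm T N p = p.coeff (N - 1) := by
  rw [residueForm_apply, modByMonic_faber_of_degree_lt T hp]

lemma residueForm_faber (hN : 1 ≤ N) {b : ℕ} (hb : b ≤ N) :
    residueForm T N (faber T b) = if b = N then 1 else 0 := by
  rw [residueForm_of_degree_lt T (degree_faber_lt_of_le T hb)]
  obtain ⟨n, rfl⟩ : ∃ n, N = n + 1 := ⟨N - 1, by omega⟩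
  split_ifs with h
  · rw [h]; exact coeff_faber_succ_self T n
  · exact coeff_faber_of_le T (by simp only [Nat.add_sub_cancel]; omega)

/-- `map_faber_mul_faber` applies with $f$ the indicator of $N$: multiples of $\varphi_{N+1}$ have
zero residue, and among $\varphi_0,\dots,\varphi_N$ only $\varphi_N$ reaches $x^{N-1}$. -/
lemma residueForm_faber_mul_faber {a b : ℕ} (ha : a < N) (hb : b < N) :
    residueForm T N (faber T (a + 1) * faber T (b + 1)) = if a + b + 1 = N then 1 else 0 := by
  refine map_faber_mul_faber T N (residueForm T N) (fun n => if n = N then 1 else 0) ?_ ?_ ?_ a b ha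
    hb.le
  · intro n hn; exact if_neg hn.ne
  · intro b hb; exact residueForm_faber T (by omega) hb
  · intro a _
    rw [if_neg (by omega), residueForm_apply,
      (modByMonic_eq_zero_iff_dvd (monic_faber_succ T N)).2 (dvd_mul_left _ _), coeff_zero]

/-- `map_faber_mul_faber` again, for the linear map "quotient by $\varphi_{N+1}$". The truncated
index encodes that the quotient is $\varphi_0=0$ as long as $a+b+1\le N$. -/
lemma faber_mul_faber_divByMonic {a b : ℕ} (ha : a < N) (hb : b < N) :
    (faber T (a + 1) * faber T (b + 1)) /ₘ faber T (N + 1) = faber T (a + b + 1 - N) := by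
  refine map_faber_mul_faber T N (divByMonicLin (monic_faber_succ T N))
    (fun n => faber T (n - N)) ?_ ?_ ?_ a b ha hb.le
  · intro n hn
    rw [Nat.sub_eq_zero_of_le hn.le, faber_zero]
  · intro b hb
    rw [Nat.sub_eq_zero_of_le hb, faber_zero, divByMonicLin_apply,
      divByMonic_eq_zero_iff (monic_faber_succ T N), degree_faber_succ]
    exact degree_faber_lt_of_le T hb
  · intro a _
    rw [divByMonicLin_apply, mul_comm, mul_divByMonic_cancel_left _ (monic_faber_succ T N)]
    congr 1; omega

/-- Nondegeneracy of the pairing: the Faber polynomial of complementary degree brings the leading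
coefficient of $p$ to $x^{N-1}$ without any reduction. -/
lemma eq_zero_of_residueForm {p : A[X]} (hp : p.degree < N)
    (h : ∀ b < N, residueForm T N (p * faber T (b + 1)) = 0) : p = 0 := by
  by_contra hp0
  have hd : p.natDegree < N := (natDegree_lt_iff_degree_lt hp0).2 hp
  have hq : (faber T (N - 1 - p.natDegree + 1)).natDegree ≤ N - 1 - p.natDegree :=
    natDegree_le_of_degree_le (degree_faber_succ_le T _)
  have h1 := h (N - 1 - p.natDegree) (by omega)
  rw [residueForm_of_degree_lt] at h1
  · have h2 := coeff_mul_add_eq_of_natDegree_le le_rfl hq (f := p)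
    rw [coeff_faber_succ_self, mul_one, show p.natDegree + (N - 1 - p.natDegree) = N - 1 by omega,
      h1] at h2
    exact hp0 (leadingCoeff_eq_zero.1 h2.symm)
  · refine degree_le_natDegree.trans_lt (Nat.cast_lt.2 ?_)
    have := natDegree_mul_le (p := p) (q := faber T (N - 1 - p.natDegree + 1))
    omega

lemma residueForm_sum_mul_faber (e : Fin N → A) (b : Fin N) :
    residueForm T N ((∑ c : Fin N, C (e c) * faber T (Fin.rev c + 1)) * faber T (b + 1)) = e b := by
  rw [sum_mul, map_sum, sum_eq_single b]
  · rw [mul_assoc, ← smul_eq_C_mul, map_smul, residueForm_faber_mul_faber T (Fin.is_lt _) b.is_lt,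
      if_pos (by rw [Fin.val_rev]; omega), smul_eq_mul, mul_one]
  · intro c _ hc
    rw [mul_assoc, ← smul_eq_C_mul, map_smul, residueForm_faber_mul_faber T (Fin.is_lt _) b.is_lt,
      if_neg, smul_zero]
    rw [Fin.val_rev]
    have := Fin.val_ne_of_ne hc
    omega
  · simp

lemma faber_sum_injective {e e' : Fin N → A}
    (h : ∑ c : Fin N, C (e c) * faber T (Fin.rev c + 1) =
      ∑ c : Fin N, C (e' c) * faber T (Fin.rev c + 1)) : e = e' := by
  funext b
  rw [← residueForm_sum_mul_faber T e b, h, residueForm_sum_mul_faber T e' b]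

lemma eq_faber_sum {p : A[X]} (hp : p.degree < N) :
    p = ∑ c : Fin N, C (residueForm T N (p * faber T (c + 1))) * faber T (Fin.rev c + 1) := by
  rw [← sub_eq_zero]
  refine eq_zero_of_residueForm T (N := N) ?_ fun b hb => ?_
  · exact (degree_sub_le _ _).trans_lt (max_lt hp (degree_faber_sum_lt T _))
  · rw [sub_mul, map_sub, sub_eq_zero]
    exact (residueForm_sum_mul_faber T (fun c : Fin N => residueForm T N (p * faber T (c + 1)))
      ⟨b, hb⟩).symm

lemma modByMonic_faber_eq_sum (p : A[X]) :
    p %ₘ faber T (N + 1) =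
      ∑ c : Fin N, C (residueForm T N (p * faber T (c + 1))) * faber T (Fin.rev c + 1) := by
  refine (eq_faber_sum T (degree_modByMonic_faber_lt T p)).trans (sum_congr rfl fun c _ => ?_)
  rw [residueForm_modByMonic_mul]

lemma faber_mul_faber_modByMonic (a b : Fin N) :
    (faber T (a + 1) * faber T (b + 1)) %ₘ faber T (N + 1) =
      ∑ c : Fin N, C (structureConst T N a b c) * faber T (Fin.rev c + 1) :=
  modByMonic_faber_eq_sum T _

lemma faber_mul_faber_eq (a b : Fin N) :
    faber T (a + 1) * faber T (b + 1) = faber T (a + b + 1 - N) * faber T (N + 1) +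
      ∑ c : Fin N, C (structureConst T N a b c) * faber T (Fin.rev c + 1) := by
  rw [← faber_mul_faber_modByMonic, ← faber_mul_faber_divByMonic T a.is_lt b.is_lt]
  linear_combination
    -modByMonic_add_div (faber T (a + 1) * faber T (b + 1)) (faber T (N + 1))

/-- The left side is symmetric in $a,b,d$, the right side not visibly so. This hidden symmetry, a
trace of associativity, is what makes the structure constants integrable. -/
lemma divByMonic_faber_mul_faber_mul_faber (a b d : Fin N) :
    (faber T (a + 1) * faber T (b + 1) * faber T (d + 1)) /ₘ faber T (N + 1) =
      faber T (a + b + 1 - N) * faber T (d + 1) +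
      ∑ c : Fin N, C (structureConst T N a b c) * faber T (Fin.rev c + d + 1 - N) := by
  rw [faber_mul_faber_eq T a b, add_mul, sum_mul, ← divByMonicLin_apply (monic_faber_succ T N),
    map_add, map_sum, divByMonicLin_apply, mul_right_comm, mul_comm _ (faber T (N + 1)),
    mul_divByMonic_cancel_left _ (monic_faber_succ T N)]
  congr 1
  refine sum_congr rfl fun c _ => ?_
  rw [mul_assoc, ← smul_eq_C_mul, map_smul, divByMonicLin_apply,
    faber_mul_faber_divByMonic T (Fin.is_lt _) d.is_lt, smul_eq_C_mul]

end Residue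

/-! ### The Euler field -/

section Euler

open MvPolynomial Finset

variable {N : ℕ}

/-- The Euler field `∑_a w_a t_a ∂/∂t_a`, multiplied by `N + 1`. -/
def eulerField (N : ℕ) : Derivation ℂ (MvPolynomial (Fin N) ℂ) (MvPolynomial (Fin N) ℂ) :=
  ∑ a : Fin N, ((weight N a : MvPolynomial (Fin N) ℂ) * X a) • pderiv a

lemma eulerField_apply (p : MvPolynomial (Fin N) ℂ) :
    eulerField N p = ∑ a : Fin N, (weight N a : MvPolynomial (Fin N) ℂ) * X a * pderiv a p := by
  rw [eulerField, ← Derivation.coeFnAddMonoidHom_apply, map_sum, Finset.sum_apply]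
  rfl

lemma eulerField_X (a : Fin N) : eulerField N (X a) = (weight N a : MvPolynomial (Fin N) ℂ) * X a := by
  rw [eulerField_apply, sum_eq_single a]
  · rw [pderiv_X_self, mul_one]
  · intro b _ hb
    rw [pderiv_X_of_ne hb.symm, mul_zero]
  · simp

lemma eulerField_of_isWeightedHomogeneous {p : MvPolynomial (Fin N) ℂ} {n : ℕ}
    (h : IsWeightedHomogeneous (weight N) p n) : eulerField N p = (n : ℂ) • p := by
  rw [eulerField_apply, Nat.cast_smul_eq_nsmul, ← h.sum_weight_X_mul_pderiv]
  refine sum_congr rfl fun a _ => ?_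
  rw [nsmul_eq_mul, mul_assoc]

lemma coeff_eulerField (p : MvPolynomial (Fin N) ℂ) (d : Fin N →₀ ℕ) :
    coeff d (eulerField N p) = (Finsupp.weight (weight N) d : ℂ) * coeff d p := by
  induction p using MvPolynomial.induction_on' with
  | monomial u a =>
    rw [eulerField_of_isWeightedHomogeneous (isWeightedHomogeneous_monomial (weight N) u a rfl),
      coeff_smul, coeff_monomial, smul_eq_mul]
    split_ifs with h
    · rw [h]
    · rw [mul_zero, mul_zero]
  | add p q hp hq => rw [map_add, coeff_add, coeff_add, hp, hq, mul_add]

lemma isWeightedHomogeneous_of_eulerField {p : MvPolynomial (Fin N) ℂ} {n : ℕ}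
    (h : eulerField N p = (n : ℂ) • p) : IsWeightedHomogeneous (weight N) p n := by
  intro d hd
  have h1 := congrArg (coeff d) h
  rw [coeff_eulerField, coeff_smul, smul_eq_mul] at h1
  exact_mod_cast mul_right_cancel₀ hd h1

lemma eq_of_pderiv_eq {p q : MvPolynomial (Fin N) ℂ} {d : ℂ} (hd : d ≠ 0)
    (hp : eulerField N p = d • p) (hq : eulerField N q = d • q)
    (h : ∀ a, pderiv a p = pderiv a q) : p = q := by
  have : d • p = d • q := by
    rw [← hp, ← hq, eulerField_apply, eulerField_apply]
    simp only [h]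
  exact smul_right_injective _ hd this

/-- The Poincaré lemma for quasi-homogeneous polynomials. -/
lemma exists_pderiv_eq (f : Fin N → MvPolynomial (Fin N) ℂ) (d : ℂ) (hd : d ≠ 0)
    (hf : ∀ a b, pderiv a (f b) = pderiv b (f a))
    (he : ∀ a, eulerField N (f a) = (d - weight N a) • f a) :
    ∃ F : MvPolynomial (Fin N) ℂ, (∀ a, pderiv a F = f a) ∧ eulerField N F = d • F := by
  have h1 : ∀ b, pderiv b (d⁻¹ • ∑ a : Fin N, (weight N a : MvPolynomial (Fin N) ℂ) * X a * f a) =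
      f b := by
    intro b
    -- By closedness the derivative of the sum is $Ef_b+w_bf_b$, and homogeneity of $f_b$ turns this
    -- into $d\,f_b$.
    have h2 : pderiv b (∑ a : Fin N, (weight N a : MvPolynomial (Fin N) ℂ) * X a * f a) =
        d • f b := by
      have h3 : ∀ a, pderiv b ((weight N a : MvPolynomial (Fin N) ℂ) * X a * f a) =
          (weight N a : MvPolynomial (Fin N) ℂ) * X a * pderiv a (f b) +
            if a = b then (weight N a : MvPolynomial (Fin N) ℂ) * f a else 0 := by
        intro a
        rw [pderiv_mul, pderiv_mul, pderiv_X, hf b a, ← map_natCast C, pderiv_C]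
        split_ifs with h
        · rw [h, Pi.single_eq_same]; ring
        · rw [Pi.single_eq_of_ne h]; ring
      rw [map_sum, sum_congr rfl fun a _ => h3 a, sum_add_distrib, ← eulerField_apply, he,
        sum_ite_eq', if_pos (mem_univ _), sub_smul, Nat.cast_smul_eq_nsmul, nsmul_eq_mul,
        sub_add_cancel]
    rw [(pderiv b).map_smul, h2, smul_smul, inv_mul_cancel₀ hd, one_smul]
  refine ⟨d⁻¹ • ∑ a : Fin N, (weight N a : MvPolynomial (Fin N) ℂ) * X a * f a, h1, ?_⟩
  rw [eulerField_apply, smul_smul, mul_inv_cancel₀ hd, one_smul]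
  exact sum_congr rfl fun a _ => by rw [h1]

end Euler

/-! ### The flat coordinates of the `A_N` singularity -/

section FlatCoordinates

open Polynomial Finset

variable {N : ℕ}

/-- The coefficients of `x(z)` in terms of the flat coordinates. -/
def flatTime (N : ℕ) (k : ℕ) : MvPolynomial (Fin N) ℂ :=
  if h : k < N then MvPolynomial.X (Fin.rev ⟨k, h⟩) else 0

lemma pderiv_flatTime (a : Fin N) (k : ℕ) :
    MvPolynomial.pderiv a (flatTime N k) = if k = Fin.rev a then 1 else 0 := by
  rw [flatTime]
  split_ifs with h1 h2 h2
  · have : Fin.rev ⟨k, h1⟩ = a := by rw [Fin.rev_eq_iff]; exact Fin.ext h2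
    rw [this, MvPolynomial.pderiv_X_self]
  · refine MvPolynomial.pderiv_X_of_ne fun h => h2 ?_
    rw [← h, Fin.rev_rev]
  · exact absurd (h2 ▸ Fin.is_lt _) h1
  · exact map_zero _

lemma eulerField_flatTime (k : ℕ) :
    eulerField N (flatTime N k) = ((k : MvPolynomial (Fin N) ℂ) + 2) * flatTime N k := by
  rw [flatTime]
  split_ifs with h
  · rw [eulerField_X]
    congr 1
    have : weight N (Fin.rev ⟨k, h⟩) = k + 2 := by
      simp only [weight, Fin.val_rev]; omega
    rw [this]; push_cast; rfl
  · rw [map_zero, mul_zero]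

lemma coeffDerivation_pderiv_faber (a : Fin N) (n : ℕ) :
    coeffDerivation (MvPolynomial.pderiv a) (faber (flatTime N) n) =
      derivative (faber (flatTime N) (n + a - N)) := by
  rw [faber_derivation_eq_derivative _ _ (Fin.rev a) (coeffDerivation_X _)]
  · congr 2
    rw [Fin.val_rev]; omega
  · intro j
    rw [coeffDerivation_C, pderiv_flatTime]
    split_ifs <;> simp

lemma gradedDerivation_faber (n : ℕ) :
    gradedDerivation (eulerField N) (faber (flatTime N) n) =
      ((n : (MvPolynomial (Fin N) ℂ)[X]) - 1) * faber (flatTime N) n := by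
  refine faber_euler _ _ (gradedDerivation_X _) (fun j => ?_) n
  rw [gradedDerivation_C, eulerField_flatTime, C_mul, C_add, map_natCast, map_ofNat]

/-- The unfolding in flat coordinates; its derivative is `φ_(N+1)`. -/
def flatUnfolding (N : ℕ) : (MvPolynomial (Fin N) ℂ)[X] :=
  C (MvPolynomial.C (1 / ((N : ℂ) + 1))) * (X * faber (flatTime N) (N + 1) +
    ∑ a : Fin N, C ((weight N a : MvPolynomial (Fin N) ℂ) * MvPolynomial.X a) *
      faber (flatTime N) (a + 1))

/-- The unfolding parameters as functions of the flat coordinates. -/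
def flatParam (N : ℕ) (a : Fin N) : MvPolynomial (Fin N) ℂ := (flatUnfolding N).coeff a

lemma C_one_div_mul (p : (MvPolynomial (Fin N) ℂ)[X]) :
    C (MvPolynomial.C (1 / ((N : ℂ) + 1))) * (((N : (MvPolynomial (Fin N) ℂ)[X]) + 1) * p) = p := by
  have : ((N : (MvPolynomial (Fin N) ℂ)[X]) + 1) = C (MvPolynomial.C ((N : ℂ) + 1)) := by simp
  rw [this, ← mul_assoc, ← C_mul, ← map_mul, one_div, inv_mul_cancel₀ (Nat.cast_add_one_ne_zero N),
    map_one, map_one, one_mul]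

/-- The symmetry $\partial_b\varphi_{a+1}=\partial_a\varphi_{b+1}$ and
$\partial_b\varphi_{N+1}=\varphi_{b+1}'$ turn the derivative of the bracket into the full Euler
operator on $\varphi_{b+1}$, of weight $b$, plus $w_b\varphi_{b+1}$; altogether $b+(N+1-b)=N+1$
times $\varphi_{b+1}$. -/
lemma coeffDerivation_pderiv_flatUnfolding (b : Fin N) :
    coeffDerivation (MvPolynomial.pderiv b) (flatUnfolding N) = faber (flatTime N) (b + 1) := by
  have h0 := gradedDerivation_faber (N := N) (b + 1)
  have h1 : coeffDerivation (eulerField N) (faber (flatTime N) (b + 1)) =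
      ∑ a : Fin N, C ((weight N a : MvPolynomial (Fin N) ℂ) * MvPolynomial.X a) *
        coeffDerivation (MvPolynomial.pderiv b) (faber (flatTime N) (a + 1)) := by
    have h2 : ∀ a : Fin N, coeffDerivation (MvPolynomial.pderiv b) (faber (flatTime N) (a + 1)) =
        coeffDerivation (MvPolynomial.pderiv a) (faber (flatTime N) (b + 1)) := by
      intro a
      rw [coeffDerivation_pderiv_faber, coeffDerivation_pderiv_faber,
        show (a : ℕ) + 1 + b = b + 1 + a by omega]
    ext1 n
    simp only [h2, finsetSum_coeff, coeff_C_mul, coeff_coeffDerivation, eulerField_apply]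
  have h3 : ∀ a : Fin N, coeffDerivation (MvPolynomial.pderiv b)
      (C ((weight N a : MvPolynomial (Fin N) ℂ) * MvPolynomial.X a) * faber (flatTime N) (a + 1)) =
      C ((weight N a : MvPolynomial (Fin N) ℂ) * MvPolynomial.X a) *
        coeffDerivation (MvPolynomial.pderiv b) (faber (flatTime N) (a + 1)) +
      if a = b then (weight N a : (MvPolynomial (Fin N) ℂ)[X]) * faber (flatTime N) (a + 1)
        else 0 := by
    intro a
    rw [Derivation.leibniz, coeffDerivation_C, Derivation.leibniz, Derivation.map_natCast,
      MvPolynomial.pderiv_X]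
    split_ifs with h
    · rw [h, Pi.single_eq_same]; simp; ring
    · rw [Pi.single_eq_of_ne h]; simp
  have h4 : coeffDerivation (MvPolynomial.pderiv b) (X * faber (flatTime N) (N + 1)) =
      X * derivative (faber (flatTime N) (b + 1)) := by
    rw [Derivation.leibniz, coeffDerivation_X, coeffDerivation_pderiv_faber, smul_zero, add_zero,
      smul_eq_mul, show N + 1 + (b : ℕ) - N = b + 1 by omega]
  rw [flatUnfolding, Derivation.leibniz, coeffDerivation_C, MvPolynomial.pderiv_C, map_zero,
    smul_zero, add_zero, smul_eq_mul, map_add, map_sum, h4, sum_congr rfl fun a _ => h3 a,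
    sum_add_distrib, ← h1, sum_ite_eq', if_pos (mem_univ _)]
  rw [gradedDerivation_apply] at h0
  conv_rhs => rw [← C_one_div_mul (faber (flatTime N) (b + 1))]
  congr 1
  rw [weight, Nat.cast_sub (by omega)]
  push_cast at h0 ⊢
  linear_combination h0

lemma derivative_flatUnfolding : derivative (flatUnfolding N) = faber (flatTime N) (N + 1) := by
  have h0 := gradedDerivation_faber (N := N) (N + 1)
  have h1 : coeffDerivation (eulerField N) (faber (flatTime N) (N + 1)) =
      ∑ a : Fin N, C ((weight N a : MvPolynomial (Fin N) ℂ) * MvPolynomial.X a) *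
        derivative (faber (flatTime N) (a + 1)) := by
    have h2 : ∀ a : Fin N, derivative (faber (flatTime N) (a + 1)) =
        coeffDerivation (MvPolynomial.pderiv a) (faber (flatTime N) (N + 1)) := by
      intro a
      rw [coeffDerivation_pderiv_faber, show N + 1 + (a : ℕ) - N = a + 1 by omega]
    ext1 n
    simp only [h2, finsetSum_coeff, coeff_C_mul, coeff_coeffDerivation, eulerField_apply]
  rw [gradedDerivation_apply, h1] at h0
  rw [flatUnfolding, derivative_C_mul, derivative_add, derivative_mul, derivative_X, one_mul,
    derivative_sum]
  simp only [derivative_C_mul]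
  conv_rhs => rw [← C_one_div_mul (faber (flatTime N) (N + 1))]
  congr 1
  push_cast at h0 ⊢
  linear_combination h0

lemma coeff_flatUnfolding_of_le (hN : 1 ≤ N) (n : ℕ) (hn : N ≤ n) :
    (flatUnfolding N).coeff n = if n = N + 1 then MvPolynomial.C (1 / ((N : ℂ) + 1)) else 0 := by
  obtain ⟨M, rfl⟩ : ∃ M, N = M + 1 := ⟨N - 1, by omega⟩
  obtain ⟨m, rfl⟩ : ∃ m, n = m + 1 := ⟨n - 1, by omega⟩
  have h1 : ∀ a : Fin (M + 1),
      (C ((weight (M + 1) a : MvPolynomial (Fin (M + 1)) ℂ) * MvPolynomial.X a) *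
        faber (flatTime (M + 1)) (a + 1)).coeff (m + 1) = 0 := by
    intro a
    rw [coeff_C_mul, coeff_faber_of_le _ (by omega), mul_zero]
  rw [flatUnfolding, coeff_C_mul, coeff_add, coeff_X_mul, finsetSum_coeff,
    sum_eq_zero fun a _ => h1 a, add_zero]
  rcases (show m = M ∨ m = M + 1 ∨ M + 2 ≤ m by omega) with rfl | rfl | h
  · rw [coeff_faber_add_two_self, if_neg (by omega), mul_zero]
  · rw [coeff_faber_succ_self, if_pos rfl, mul_one]
  · rw [coeff_faber_of_le _ (by omega), if_neg (by omega), mul_zero]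

lemma unfolding_flatParam (hN : 1 ≤ N) : unfolding (flatParam N) = flatUnfolding N := by
  ext1 n
  rw [unfolding, coeff_add, finsetSum_coeff, coeff_C_mul, coeff_X_pow]
  simp only [coeff_C_mul, coeff_X_pow, mul_ite, mul_one, mul_zero]
  rcases Nat.lt_or_ge n N with h | h
  · rw [if_neg (by omega), zero_add, sum_eq_single ⟨n, h⟩]
    · rw [if_pos rfl]; rfl
    · intro b _ hb
      rw [if_neg]
      exact fun h' => hb (Fin.ext h'.symm)
    · simp
  · rw [coeff_flatUnfolding_of_le hN n h, sum_eq_zero, add_zero]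
    · rfl
    · intro a _
      rw [if_neg (by omega)]

lemma derivative_unfolding_flatParam (hN : 1 ≤ N) :
    derivative (unfolding (flatParam N)) = faber (flatTime N) (N + 1) := by
  rw [unfolding_flatParam hN, derivative_flatUnfolding]

lemma pderiv_flatParam (a b : Fin N) :
    MvPolynomial.pderiv b (flatParam N a) = (faber (flatTime N) (b + 1)).coeff a := by
  rw [flatParam, ← coeff_coeffDerivation, coeffDerivation_pderiv_flatUnfolding]

lemma tangentClass_flatParam (b : Fin N) :
    tangentClass (flatParam N) b = faber (flatTime N) (b + 1) := by
  rw [tangentClass]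
  simp only [pderiv_flatParam]
  rw [Fin.sum_univ_eq_sum_range
    (fun a => C ((faber (flatTime N) (b + 1)).coeff a) * X ^ a) N]
  refine (as_sum_range_C_mul_X_pow' _ ?_).symm
  exact (natDegree_lt_iff_degree_lt (monic_faber_succ _ _).ne_zero).2
    (degree_faber_lt_of_le _ b.is_lt)

/-- With $x$ of weight $1$ the unfolding is homogeneous of weight $N+1$; its coefficient of $x^a$
loses $a$. -/
lemma eulerField_flatParam (a : Fin N) :
    eulerField N (flatParam N a) = (weight N a : ℂ) • flatParam N a := by
  have h : gradedDerivation (eulerField N) (flatUnfolding N) =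
      ((N : (MvPolynomial (Fin N) ℂ)[X]) + 1) * flatUnfolding N := by
    have h1 : ∀ b : Fin N, gradedDerivation (eulerField N)
        (C ((weight N b : MvPolynomial (Fin N) ℂ) * MvPolynomial.X b) *
          faber (flatTime N) (b + 1)) = ((N : (MvPolynomial (Fin N) ℂ)[X]) + 1) *
        (C ((weight N b : MvPolynomial (Fin N) ℂ) * MvPolynomial.X b) *
          faber (flatTime N) (b + 1)) := by
      intro b
      rw [Derivation.leibniz, gradedDerivation_faber, gradedDerivation_C, Derivation.leibniz,
        Derivation.map_natCast, eulerField_X,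
        smul_zero, add_zero, smul_eq_mul, smul_eq_mul, smul_eq_mul]
      have h2 : (weight N b : (MvPolynomial (Fin N) ℂ)[X]) = N + 1 - b := by
        rw [weight, Nat.cast_sub (by omega)]; push_cast; rfl
      simp only [C_mul, map_natCast, h2]
      push_cast
      ring
    rw [flatUnfolding, Derivation.leibniz, gradedDerivation_C, ← MvPolynomial.algebraMap_eq,
      Derivation.map_algebraMap, map_zero, smul_zero, add_zero, smul_eq_mul, map_add, map_sum,
      sum_congr rfl fun b _ => h1 b, ← mul_sum, Derivation.leibniz, gradedDerivation_faber,
      gradedDerivation_X, smul_eq_mul, smul_eq_mul]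
    push_cast
    ring
  have h1 := congrArg (fun p => Polynomial.coeff p (a : ℕ)) h
  simp only [coeff_gradedDerivation] at h1
  have h2 : ((N : (MvPolynomial (Fin N) ℂ)[X]) + 1) = C ((N : MvPolynomial (Fin N) ℂ) + 1) := by simp
  rw [h2, coeff_C_mul] at h1
  rw [Nat.cast_smul_eq_nsmul, nsmul_eq_mul, weight, Nat.cast_sub (by omega), flatParam]
  push_cast
  linear_combination h1

end FlatCoordinates

/-! ### The potential -/

section Existence

open Polynomial Finset

variable {N : ℕ}

/-- The structure constants of the `A_N` singularity in flat coordinates. -/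
abbrev flatConst (N : ℕ) (a b c : Fin N) : MvPolynomial (Fin N) ℂ :=
  structureConst (flatTime N) N a b c

lemma flatConst_swap_left (a b c : Fin N) : flatConst N a b c = flatConst N b a c :=
  structureConst_swap_left _ a b c

lemma flatConst_swap_right (a b c : Fin N) : flatConst N a b c = flatConst N a c b :=
  structureConst_swap_right _ a b c

/-- Apply $\partial_d$ to the division identity `faber_mul_faber_eq` and antisymmetrise in $b$ and
$d$. What remains is the $x$-derivative of the difference between two expressions for the quotient
of $\varphi_{a+1}\varphi_{b+1}\varphi_{d+1}$ by $\varphi_{N+1}$, hence zero. -/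
lemma pderiv_flatConst (a b c d : Fin N) :
    MvPolynomial.pderiv d (flatConst N a b c) = MvPolynomial.pderiv b (flatConst N a d c) := by
  have key : ∀ b d : Fin N,
      ∑ c : Fin N, C (MvPolynomial.pderiv d (flatConst N a b c)) *
        faber (flatTime N) (Fin.rev c + 1) =
      derivative (faber (flatTime N) (a + d + 1 - N)) * faber (flatTime N) (b + 1) +
      faber (flatTime N) (a + 1) * derivative (faber (flatTime N) (b + d + 1 - N)) -
      derivative (faber (flatTime N) (a + b + d + 1 - N - N)) * faber (flatTime N) (N + 1) -
      faber (flatTime N) (a + b + 1 - N) * derivative (faber (flatTime N) (d + 1)) -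
      ∑ c : Fin N, C (flatConst N a b c) *
        derivative (faber (flatTime N) (Fin.rev c + d + 1 - N)) := by
    intro b d
    have h := congrArg (coeffDerivation (MvPolynomial.pderiv d))
      (faber_mul_faber_eq (flatTime N) a b)
    have h1 : ∀ c : Fin N, coeffDerivation (MvPolynomial.pderiv d) (C (flatConst N a b c) *
          faber (flatTime N) (Fin.rev c + 1)) =
        C (flatConst N a b c) * derivative (faber (flatTime N) (Fin.rev c + d + 1 - N)) +
        C (MvPolynomial.pderiv d (flatConst N a b c)) * faber (flatTime N) (Fin.rev c + 1) := by
      intro c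
      rw [Derivation.leibniz, coeffDerivation_C, coeffDerivation_pderiv_faber, smul_eq_mul,
        smul_eq_mul, add_right_comm _ 1, mul_comm (faber (flatTime N) (Fin.rev c + 1))]
    rw [map_add, map_sum, sum_congr rfl fun c _ => h1 c, sum_add_distrib, Derivation.leibniz,
      Derivation.leibniz] at h
    simp only [coeffDerivation_pderiv_faber, smul_eq_mul] at h
    rw [add_right_comm _ 1, add_right_comm _ 1,
      show N + 1 + (d : ℕ) - N = d + 1 by omega] at h
    -- The two orders of truncated subtraction agree because $d<N$: if the inner one truncates, both
    -- indices are zero.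
    have h2 : faber (flatTime N) (a + b + 1 - N + d - N) =
        faber (flatTime N) (a + b + d + 1 - N - N) := by
      rcases Nat.lt_or_ge (a + b + 1) N with h | h
      · rw [Nat.sub_eq_zero_of_le (by omega : (a : ℕ) + b + 1 - N + d ≤ N),
          Nat.sub_eq_zero_of_le (by omega : (a : ℕ) + b + d + 1 - N ≤ N)]
      · congr 1; omega
    rw [h2] at h
    linear_combination -h
  -- The same quotient grouped as $(ab)d$ and as $(ad)b$; the structure constants are constant in
  -- $x$.
  have assoc := congrArg derivative
    ((divByMonic_faber_mul_faber_mul_faber (flatTime N) a b d).symm.trans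
      ((congrArg (· /ₘ faber (flatTime N) (N + 1)) (mul_right_comm _ _ _)).trans
        (divByMonic_faber_mul_faber_mul_faber (flatTime N) a d b)))
  simp only [derivative_add, derivative_mul, derivative_sum, derivative_C, zero_mul, zero_add]
    at assoc
  have h := faber_sum_injective (flatTime N)
    (e := fun c => MvPolynomial.pderiv d (flatConst N a b c))
    (e' := fun c => MvPolynomial.pderiv b (flatConst N a d c)) ?_
  · exact congrFun h c
  · rw [key b d, key d b, add_right_comm (a : ℕ) d b, add_comm (d : ℕ) b]
    linear_combination -assoc

/-- The triple product has weight $a+b+c$, division by the homogeneous $\varphi_{N+1}$ preserves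
weights, and taking the coefficient of $x^{N-1}$ subtracts $N-1$. -/
lemma eulerField_flatConst (hN : 1 ≤ N) (a b c : Fin N) :
    eulerField N (flatConst N a b c) = (((a : ℕ) + b + c + 1 : ℂ) - N) • flatConst N a b c := by
  set P := faber (flatTime N) (N + 1) with hP
  set p := faber (flatTime N) (a + 1) * faber (flatTime N) (b + 1) * faber (flatTime N) (c + 1)
    with hp
  have h1 : gradedDerivation (eulerField N) p =
      C (MvPolynomial.C ((a : ℕ) + b + c : ℂ)) * p := by
    rw [hp, Derivation.leibniz, Derivation.leibniz, gradedDerivation_faber, gradedDerivation_faber,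
      gradedDerivation_faber]
    simp only [smul_eq_mul, map_add, map_natCast]
    push_cast
    ring
  have h2 : gradedDerivation (eulerField N) P = C (MvPolynomial.C (N : ℂ)) * P := by
    rw [hP, gradedDerivation_faber]
    simp only [map_natCast]
    push_cast
    ring
  have h3 := modByMonic_add_div p P
  have hdeg : (p %ₘ P).degree < N := degree_modByMonic_faber_lt _ p
  have h4 : gradedDerivation (eulerField N) (p %ₘ P) =
      C (MvPolynomial.C ((a : ℕ) + b + c : ℂ)) * (p %ₘ P) := by
    have h5 := congrArg (gradedDerivation (eulerField N)) h3
    rw [map_add, Derivation.leibniz, h1, h2, smul_eq_mul, smul_eq_mul] at h5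
    rw [← sub_eq_zero]
    set r := gradedDerivation (eulerField N) (p %ₘ P) -
      C (MvPolynomial.C ((a : ℕ) + b + c : ℂ)) * (p %ₘ P) with hr
    have hrdeg : r.degree < N := by
      rw [degree_lt_iff_coeff_zero] at hdeg ⊢
      intro m hm
      rw [hr, coeff_sub, coeff_gradedDerivation, coeff_C_mul, hdeg m hm, map_zero, mul_zero,
        mul_zero, add_zero, sub_zero]
    -- The defect $r$ of homogeneity of the remainder is a multiple of $P$ of degree below $N$,
    -- hence zero.
    have hdvd : P ∣ r := by
      refine ⟨C (MvPolynomial.C ((a : ℕ) + b + c : ℂ)) * (p /ₘ P) -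
        gradedDerivation (eulerField N) (p /ₘ P) - C (MvPolynomial.C (N : ℂ)) * (p /ₘ P), ?_⟩
      rw [hr]
      linear_combination h5 - C (MvPolynomial.C ((a : ℕ) + b + c : ℂ)) * h3
    have hmod := (modByMonic_eq_zero_iff_dvd (monic_faber_succ (flatTime N) N)).2 hdvd
    rwa [modByMonic_faber_of_degree_lt _ hrdeg] at hmod
  have h6 := congrArg (fun q => Polynomial.coeff q (N - 1)) h4
  simp only [coeff_gradedDerivation, coeff_C_mul] at h6
  change eulerField N ((p %ₘ P).coeff (N - 1)) = _ • ((p %ₘ P).coeff (N - 1))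
  rw [Nat.cast_sub hN] at h6
  rw [MvPolynomial.smul_eq_C_mul]
  simp only [map_add, map_sub, map_natCast, map_one] at h6 ⊢
  push_cast at h6
  linear_combination h6

lemma cast_weight (a : Fin N) : (weight N a : ℂ) = (N : ℂ) + 1 - (a : ℕ) := by
  rw [weight, Nat.cast_sub (by omega)]
  push_cast
  rfl

/-- Three integrations by `exists_pderiv_eq`, each adding the weight of its variable: from
$a+b+c+1-N$ to $a+b+2$, $a+N+3$ and $2N+4$. The new weights are positive, so no integration
constants arise and the symmetry of `G` passes up from the structure constants. -/
lemma exists_flatPotential (hN : 1 ≤ N) :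
    ∃ F : MvPolynomial (Fin N) ℂ, (∀ a b c, MvPolynomial.pderiv a (MvPolynomial.pderiv b
      (MvPolynomial.pderiv c F)) = flatConst N a b c) ∧
      MvPolynomial.IsWeightedHomogeneous (weight N) F (2 * N + 4) := by
  have hG : ∀ a b : Fin N, ∃ G : MvPolynomial (Fin N) ℂ,
      (∀ c, MvPolynomial.pderiv c G = flatConst N a b c) ∧
      eulerField N G = ((((a : ℕ) + (b : ℕ) + 2 : ℕ) : ℂ)) • G := by
    intro a b
    refine exists_pderiv_eq _ _ (Nat.cast_ne_zero.2 (by omega)) (fun c d => ?_) (fun c => ?_)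
    · rw [flatConst_swap_right a b d, pderiv_flatConst, flatConst_swap_right a c b]
    · rw [eulerField_flatConst hN, cast_weight]
      congr 1; push_cast; ring
  choose G hG hGe using hG
  have hGsymm : ∀ a b, G a b = G b a := by
    intro a b
    refine eq_of_pderiv_eq (Nat.cast_ne_zero.2 (by omega : (a : ℕ) + b + 2 ≠ 0)) (hGe a b) ?_ ?_
    · rw [hGe b a, add_comm (b : ℕ)]
    · intro c; rw [hG, hG, flatConst_swap_left]
  have hH : ∀ a : Fin N, ∃ H : MvPolynomial (Fin N) ℂ,
      (∀ b, MvPolynomial.pderiv b H = G a b) ∧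
      eulerField N H = ((((a : ℕ) + N + 3 : ℕ) : ℂ)) • H := by
    intro a
    refine exists_pderiv_eq _ _ (Nat.cast_ne_zero.2 (by omega)) (fun b c => ?_) (fun b => ?_)
    · rw [hG, hG, flatConst_swap_right]
    · rw [hGe, cast_weight]
      congr 1; push_cast; ring
  choose H hH hHe using hH
  obtain ⟨F, hF, hFe⟩ := exists_pderiv_eq H ((2 * N + 4 : ℕ) : ℂ)
    (Nat.cast_ne_zero.2 (by omega)) (fun a b => by rw [hH, hH, hGsymm]) (fun a => by
      rw [hHe, cast_weight]; congr 1; push_cast; ring)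
  refine ⟨F, fun a b c => ?_, isWeightedHomogeneous_of_eulerField hFe⟩
  rw [hF, hH, hG, flatConst_swap_right c b a, flatConst_swap_left c a b, flatConst_swap_right a c b]

lemma flat_flatParam (hN : 1 ≤ N) (a b : Fin N) :
    (jacobiReduce (flatParam N) (tangentClass (flatParam N) a *
      tangentClass (flatParam N) b)).coeff (N - 1) = if b = Fin.rev a then 1 else 0 := by
  rw [jacobiReduce, derivative_unfolding_flatParam hN, tangentClass_flatParam,
    tangentClass_flatParam, ← residueForm_apply, residueForm_faber_mul_faber _ a.is_lt b.is_lt]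
  refine if_congr ?_ rfl rfl
  rw [Fin.ext_iff, Fin.val_rev]
  omega

lemma coeff_single_eq_constantCoeff_pderiv (p : MvPolynomial (Fin N) ℂ) (a : Fin N) :
    MvPolynomial.coeff (Finsupp.single a 1) p =
      MvPolynomial.constantCoeff (MvPolynomial.pderiv a p) := by
  rw [MvPolynomial.constantCoeff_eq, MvPolynomial.coeff_pderiv]
  simp

theorem exists_isPotentialA (hN : 1 ≤ N) : ∃ F : MvPolynomial (Fin N) ℂ, IsPotentialA N F := by
  obtain ⟨F, hF, hFw⟩ := exists_flatPotential hN
  refine ⟨F, flatParam N, ?_, ?_, flat_flatParam hN, ?_, hFw⟩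
  · exact fun a => isWeightedHomogeneous_of_eulerField (eulerField_flatParam a)
  · intro a
    rw [coeff_single_eq_constantCoeff_pderiv, pderiv_flatParam, coeff_faber_succ_self, map_one]
  · intro a b
    rw [jacobiReduce, derivative_unfolding_flatParam hN, tangentClass_flatParam,
      tangentClass_flatParam, faber_mul_faber_modByMonic]
    exact sum_congr rfl fun c _ => by rw [hF, tangentClass_flatParam]

end Existence

/-! ### Uniqueness of the flat coordinates -/

section Uniqueness

open Finset

variable {N : ℕ}

/-! ### Chain rule and differential criteria for polynomials. -/

section Calculus

open MvPolynomial

lemma derivation_aeval {σ : Type*} [Fintype σ] {R A : Type*} [CommRing R] [CommRing A] [Algebra R A]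
    (D : Derivation R A A) (τ : σ → A) (p : MvPolynomial σ R) :
    D (aeval τ p) = ∑ b, aeval τ (pderiv b p) * D (τ b) := by
  classical
  induction p using MvPolynomial.induction_on with
  | C a => simp [Derivation.map_algebraMap]
  | add p q hp hq => simp only [map_add, hp, hq, add_mul, sum_add_distrib]
  | mul_X p a hp =>
    have h : ∀ b, aeval τ (pderiv b (p * X a)) * D (τ b) =
        τ a * (aeval τ (pderiv b p) * D (τ b)) + if b = a then aeval τ p * D (τ a) else 0 := by
      intro b
      rw [pderiv_mul, pderiv_X]
      split_ifs with h
      · rw [h, Pi.single_eq_same, mul_one, map_add, map_mul, aeval_X]; ring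
      · rw [Pi.single_eq_of_ne' h, mul_zero, add_zero, map_mul, aeval_X, add_zero]; ring
    rw [map_mul, aeval_X, Derivation.leibniz, hp, sum_congr rfl fun b _ => h b, sum_add_distrib,
      ← mul_sum, sum_ite_eq', if_pos (mem_univ _), smul_eq_mul, smul_eq_mul, add_comm]

lemma eq_zero_of_mem_support_of_pderiv_eq_zero {p : MvPolynomial (Fin N) ℂ} {b : Fin N}
    (h : pderiv b p = 0) {d : Fin N →₀ ℕ} (hd : d ∈ p.support) : d b = 0 := by
  by_contra hb
  have h1 := coeff_pderiv (i := b) p (d - Finsupp.single b 1)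
  have h2 : d - Finsupp.single b 1 + Finsupp.single b 1 = d :=
    tsub_add_cancel_of_le (Finsupp.single_le_iff.2 (by omega))
  rw [h, coeff_zero, h2] at h1
  rcases mul_eq_zero.1 h1.symm with h3 | h3
  · exact mem_support_iff.1 hd h3
  · exact Nat.cast_add_one_ne_zero _ h3

lemma aeval_update_of_pderiv_eq_zero {p : MvPolynomial (Fin N) ℂ} {b : Fin N}
    (h : pderiv b p = 0) {A : Type*} [CommRing A] [Algebra ℂ A] (τ : Fin N → A) (x : A) :
    aeval (Function.update τ b x) p = aeval τ p := by
  rw [aeval_def, aeval_def, eval₂_eq', eval₂_eq']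
  refine sum_congr rfl fun d hd => ?_
  congr 1
  refine prod_congr rfl fun i _ => ?_
  rcases eq_or_ne i b with rfl | hi
  · rw [eq_zero_of_mem_support_of_pderiv_eq_zero h hd, pow_zero, pow_zero]
  · rw [Function.update_of_ne hi]

lemma eq_C_of_pderiv_eq_zero {p : MvPolynomial (Fin N) ℂ} (h : ∀ b, pderiv b p = 0) :
    p = C (constantCoeff p) := by
  ext d
  rw [coeff_C, constantCoeff_eq]
  split_ifs with hd
  · rw [hd]
  · by_contra hc
    refine hd (Finsupp.ext fun b => ?_)
    exact (eq_zero_of_mem_support_of_pderiv_eq_zero (h b) (mem_support_iff.2 hc)).symm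

lemma pderiv_comm {σ : Type*} (a b : σ) (p : MvPolynomial σ ℂ) :
    pderiv a (pderiv b p) = pderiv b (pderiv a p) := by
  classical
  ext d
  simp only [coeff_pderiv, Finsupp.add_apply, add_right_comm d]
  rcases eq_or_ne a b with rfl | h
  · rfl
  · rw [Finsupp.single_eq_of_ne h, Finsupp.single_eq_of_ne h.symm, add_zero, add_zero]
    ring

lemma eulerField_aeval {τ : Fin N → MvPolynomial (Fin N) ℂ}
    (hτ : ∀ a, eulerField N (τ a) = (weight N a : ℂ) • τ a) (p : MvPolynomial (Fin N) ℂ) :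
    eulerField N (aeval τ p) = aeval τ (eulerField N p) := by
  rw [derivation_aeval, eulerField_apply, map_sum]
  refine sum_congr rfl fun a _ => ?_
  rw [hτ, map_mul, map_mul, aeval_X, map_natCast, Nat.cast_smul_eq_nsmul, nsmul_eq_mul, mul_comm]

end Calculus

/-- The system $v_a=t_a+(\text{polynomial in }t_b,\ b>a)$ is triangular, so it can be solved for $t$
from the highest index down; homogeneity is preserved at each step. -/
lemma exists_aeval_flatParam_eq {V : Fin N → MvPolynomial (Fin N) ℂ}
    (hV : ∀ a, eulerField N (V a) = (weight N a : ℂ) • V a) :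
    ∃ τ : Fin N → MvPolynomial (Fin N) ℂ,
      (∀ a, eulerField N (τ a) = (weight N a : ℂ) • τ a) ∧
      ∀ a, MvPolynomial.aeval τ (flatParam N a) = V a := by
  have key : ∀ k ≤ N, ∃ τ : Fin N → MvPolynomial (Fin N) ℂ,
      (∀ a, eulerField N (τ a) = (weight N a : ℂ) • τ a) ∧
      ∀ a : Fin N, N - k ≤ a → MvPolynomial.aeval τ (flatParam N a) = V a := by
    intro k
    induction k with
    | zero => exact fun _ => ⟨0, fun a => by simp, fun a ha => absurd a.is_lt (by omega)⟩
    | succ k ih =>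
      intro hk
      obtain ⟨τ, hτ, hτV⟩ := ih (by omega)
      obtain ⟨b, hb⟩ : ∃ b : Fin N, (b : ℕ) = N - (k + 1) := ⟨⟨N - (k + 1), by omega⟩, rfl⟩
      -- `p` is the part of $v_b$ free of $t_b$, so updating the value at `b` does not change it.
      set p := flatParam N b - MvPolynomial.X b with hp
      have hpb : MvPolynomial.pderiv b p = 0 := by
        rw [hp, map_sub, MvPolynomial.pderiv_X_self, pderiv_flatParam, coeff_faber_succ_self,
          sub_self]
      have hpe : eulerField N p = (weight N b : ℂ) • p := by
        rw [hp, map_sub, eulerField_flatParam, eulerField_X, smul_sub, Nat.cast_smul_eq_nsmul,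
          Nat.cast_smul_eq_nsmul, nsmul_eq_mul, nsmul_eq_mul]
      refine ⟨Function.update τ b (V b - MvPolynomial.aeval τ p), fun a => ?_, fun a ha => ?_⟩
      · rcases eq_or_ne a b with rfl | hab
        · rw [Function.update_self, map_sub, hV, eulerField_aeval hτ, hpe, map_smul, smul_sub]
        · rw [Function.update_of_ne hab, hτ]
      · rcases eq_or_ne a b with rfl | hab
        · have h1 : flatParam N a = MvPolynomial.X a + p := by rw [hp]; ring
          rw [h1, map_add, aeval_update_of_pderiv_eq_zero hpb, MvPolynomial.aeval_X,
            Function.update_self, sub_add_cancel]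
        · have := Fin.val_ne_of_ne hab
          rw [aeval_update_of_pderiv_eq_zero, hτV a (by omega)]
          rw [pderiv_flatParam, coeff_faber_of_le _ (by omega)]
  obtain ⟨τ, hτ, hτV⟩ := key N le_rfl
  exact ⟨τ, hτ, fun a => hτV a (by omega)⟩

/-- An isometry between flat coordinate systems is affine. -/
lemma pderiv_pderiv_eq_zero_of_isometry (τ : Fin N → MvPolynomial (Fin N) ℂ)
    (h : ∀ a b, ∑ e : Fin N, MvPolynomial.pderiv a (τ e) * MvPolynomial.pderiv b (τ (Fin.rev e)) =
      if b = Fin.rev a then 1 else 0) (a b c : Fin N) :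
    MvPolynomial.pderiv a (MvPolynomial.pderiv b (τ c)) = 0 := by
  let M : Matrix (Fin N) (Fin N) (MvPolynomial (Fin N) ℂ) :=
    Matrix.of fun a b => MvPolynomial.pderiv a (τ b)
  let L : Matrix (Fin N) (Fin N) (MvPolynomial (Fin N) ℂ) :=
    Matrix.of fun e b => MvPolynomial.pderiv (Fin.rev b) (τ (Fin.rev e))
  have hML : M * L = 1 := by
    ext1 a b
    rw [Matrix.mul_apply, Matrix.one_apply]
    refine (h a (Fin.rev b)).trans (if_congr ?_ rfl rfl)
    rw [Fin.rev_inj, eq_comm]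
  have hLM : L * M = 1 := mul_eq_one_comm.1 hML
  let Γ : Fin N → Fin N → Fin N → MvPolynomial (Fin N) ℂ := fun c a b =>
    ∑ e : Fin N, MvPolynomial.pderiv c (MvPolynomial.pderiv a (τ e)) *
      MvPolynomial.pderiv b (τ (Fin.rev e))
  have hsymm : ∀ c a b, Γ c a b = Γ a c b := fun c a b =>
    sum_congr rfl fun e _ => by rw [pderiv_comm]
  have hanti : ∀ c a b, Γ c a b + Γ c b a = 0 := by
    intro c a b
    have h1 := congrArg (MvPolynomial.pderiv c) (h a b)
    have h2 : Γ c b a = ∑ e : Fin N, MvPolynomial.pderiv a (τ e) *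
        MvPolynomial.pderiv c (MvPolynomial.pderiv b (τ (Fin.rev e))) := by
      refine (Equiv.sum_comp Fin.revPerm _).symm.trans (sum_congr rfl fun e _ => ?_)
      rw [Fin.revPerm_apply, Fin.rev_rev, mul_comm]
    rw [map_sum] at h1
    simp only [MvPolynomial.pderiv_mul, sum_add_distrib] at h1
    rw [h2]
    refine h1.trans ?_
    split_ifs <;> simp
  have hzero : ∀ c a b, Γ c a b = 0 := by
    intro c a b
    -- The Levi-Civita argument: a tensor symmetric in its first two indices and antisymmetric in
    -- its last two is zero.
    have h2 : (2 : MvPolynomial (Fin N) ℂ) * Γ c a b = 0 := by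
      linear_combination hsymm c a b + hanti a c b - hsymm a b c - hanti b a c + hsymm b c a +
        hanti c b a
    exact (mul_eq_zero.1 h2).resolve_left two_ne_zero
  let v : Fin N → MvPolynomial (Fin N) ℂ :=
    fun e => MvPolynomial.pderiv a (MvPolynomial.pderiv b (τ e))
  have hv : Matrix.vecMul v L = 0 := funext fun e => hzero a b (Fin.rev e)
  have hv2 : v = 0 := by
    rw [← Matrix.vecMul_one v, ← hLM, ← Matrix.vecMul_vecMul, hv, Matrix.zero_vecMul]
  exact congrFun hv2 c

lemma weight_injective : Function.Injective (weight N) := by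
  intro a b h
  rw [weight, weight] at h
  exact Fin.ext (by omega)

lemma weight_pos (a : Fin N) : 0 < weight N a := by
  rw [weight]; omega

/-- Differentiating the Euler relation gives $(w_a-w_b)\,\partial_a\tau=0$, and the weights are
pairwise distinct; the Euler relation itself then recovers $\tau$. -/
lemma eq_X_mul_of_pderiv_pderiv_eq_zero {τ : MvPolynomial (Fin N) ℂ} {b : Fin N}
    (he : eulerField N τ = (weight N b : ℂ) • τ)
    (h : ∀ a c, MvPolynomial.pderiv a (MvPolynomial.pderiv c τ) = 0) :
    τ = MvPolynomial.X b * MvPolynomial.pderiv b τ ∧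
      ∀ a, a ≠ b → MvPolynomial.pderiv a τ = 0 := by
  have hne : ∀ a, a ≠ b → MvPolynomial.pderiv a τ = 0 := by
    intro a hab
    have h1 := congrArg (MvPolynomial.pderiv a) he
    have h2 : MvPolynomial.pderiv a (eulerField N τ) =
        (weight N a : ℂ) • MvPolynomial.pderiv a τ := by
      rw [eulerField_apply, map_sum, sum_eq_single a]
      · rw [MvPolynomial.pderiv_mul, h, mul_zero, add_zero, MvPolynomial.pderiv_mul,
          MvPolynomial.pderiv_X_self, Derivation.map_natCast, zero_mul, zero_add, mul_one,
          Nat.cast_smul_eq_nsmul, nsmul_eq_mul]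
      · intro c _ hc
        rw [MvPolynomial.pderiv_mul, h, mul_zero, add_zero, MvPolynomial.pderiv_mul,
          MvPolynomial.pderiv_X_of_ne hc, Derivation.map_natCast, zero_mul, zero_add, mul_zero,
          zero_mul]
      · simp
    rw [h2, (MvPolynomial.pderiv a).map_smul, ← sub_eq_zero, ← sub_smul] at h1
    refine (smul_eq_zero.1 h1).resolve_left fun h3 => hab (weight_injective ?_)
    exact_mod_cast sub_eq_zero.1 h3
  refine ⟨?_, hne⟩
  rw [eulerField_apply, sum_eq_single b (fun a _ ha => by rw [hne a ha, mul_zero]) (by simp),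
    mul_assoc, ← nsmul_eq_mul, ← Nat.cast_smul_eq_nsmul ℂ] at he
  exact (smul_right_injective _ (Nat.cast_ne_zero.2 (weight_pos b).ne') he).symm

open Polynomial in
/-- The flat coordinates of the `A_N` singularity are unique. -/
lemma IsFlatPotential.eq_flatParam (hN : 1 ≤ N) {V : Fin N → MvPolynomial (Fin N) ℂ}
    {F : MvPolynomial (Fin N) ℂ} (hVF : IsFlatPotential N V F) : V = flatParam N := by
  obtain ⟨τ, hτ, hτV⟩ := exists_aeval_flatParam_eq fun a =>
    eulerField_of_isWeightedHomogeneous (hVF.coord_homogeneous a)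
  set s : MvPolynomial (Fin N) ℂ →ₐ[ℂ] MvPolynomial (Fin N) ℂ := MvPolynomial.aeval τ with hs
  -- Faber polynomials commute with maps of coefficients, so the Jacobian ring of `V` is again
  -- described by Faber polynomials, with the substituted parameters; in general these are no longer
  -- coordinates.
  set T : ℕ → MvPolynomial (Fin N) ℂ := fun k => s (flatTime N k) with hT
  have hmap : ∀ n, (faber (flatTime N) n).map (s : _ →+* MvPolynomial (Fin N) ℂ) = faber T n :=
    fun n => map_faber _ _ n
  have hunf : unfolding V = (unfolding (flatParam N)).map (s : _ →+* MvPolynomial (Fin N) ℂ) := by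
    simp only [unfolding, Polynomial.map_add, Polynomial.map_mul, Polynomial.map_pow,
      Polynomial.map_sum, map_C, map_X, RingHom.coe_coe, AlgHom.commutes, hτV]
  have hder : derivative (unfolding V) = faber T (N + 1) := by
    rw [hunf, derivative_map, derivative_unfolding_flatParam hN, hmap]
  have htan : ∀ a, tangentClass V a =
      ∑ b : Fin N, C (MvPolynomial.pderiv a (τ b)) * faber T (b + 1) := by
    intro a
    have h1 : ∀ b : Fin N, faber T (b + 1) =
        ∑ e : Fin N, C (s (MvPolynomial.pderiv b (flatParam N e))) * X ^ (e : ℕ) := by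
      intro b
      rw [← hmap, ← tangentClass_flatParam, tangentClass]
      simp only [Polynomial.map_mul, Polynomial.map_pow,
        Polynomial.map_sum, map_C, map_X, RingHom.coe_coe]
    simp only [h1, mul_sum]
    rw [sum_comm, tangentClass]
    refine sum_congr rfl fun e _ => ?_
    rw [← hτV e, derivation_aeval, map_sum, sum_mul]
    refine sum_congr rfl fun b _ => ?_
    rw [mul_comm (MvPolynomial.aeval τ _), C_mul, mul_assoc]
  -- The pairing is antidiagonal both on the substituted Faber polynomials and, by `hVF.flat`, in
  -- the coordinates $t$; hence the Jacobian matrix of $\tau$ is orthogonal for it.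
  have hiso : ∀ a b, ∑ e : Fin N, MvPolynomial.pderiv a (τ e) *
      MvPolynomial.pderiv b (τ (Fin.rev e)) = if b = Fin.rev a then 1 else 0 := by
    intro a b
    rw [← hVF.flat a b, jacobiReduce, hder, ← residueForm_apply, htan, htan, sum_mul, map_sum]
    refine sum_congr rfl fun e _ => ?_
    rw [mul_assoc, ← smul_eq_C_mul, map_smul, smul_eq_mul, mul_sum, map_sum,
      sum_eq_single (Fin.rev e)]
    · rw [mul_left_comm, ← smul_eq_C_mul, map_smul,
        residueForm_faber_mul_faber _ e.is_lt (Fin.is_lt _),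
        if_pos (by rw [Fin.val_rev]; omega), smul_eq_mul, mul_one]
    · intro e' _ he'
      rw [mul_left_comm, ← smul_eq_C_mul, map_smul,
        residueForm_faber_mul_faber _ e.is_lt e'.is_lt, if_neg, smul_zero]
      have := Fin.val_ne_of_ne he'
      rw [Fin.val_rev] at this
      omega
    · simp
  have hconst := pderiv_pderiv_eq_zero_of_isometry τ hiso
  have hτX : τ = MvPolynomial.X := by
    funext b
    obtain ⟨h1, h2⟩ := eq_X_mul_of_pderiv_pderiv_eq_zero (hτ b) fun a c => hconst a c b
    have h3 : MvPolynomial.pderiv b (V b) = MvPolynomial.pderiv b (τ b) := by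
      rw [← hτV, derivation_aeval, sum_eq_single b]
      · rw [pderiv_flatParam, coeff_faber_succ_self, map_one, one_mul]
      · intro c _ hc
        rw [(eq_X_mul_of_pderiv_pderiv_eq_zero (hτ c) fun a e => hconst a e c).2 b hc.symm,
          mul_zero]
      · simp
    have h4 := hVF.coord_normalized b
    rw [coeff_single_eq_constantCoeff_pderiv, h3] at h4
    rw [h1, eq_C_of_pderiv_eq_zero (fun a => hconst a b b), h4, map_one, mul_one]
  funext a
  rw [← hτV a, hs, hτX, MvPolynomial.aeval_X_left_apply]

lemma IsPotentialA.pderiv_eq_flatConst (hN : 1 ≤ N) {F : MvPolynomial (Fin N) ℂ}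
    (hF : IsPotentialA N F) (a b c : Fin N) :
    MvPolynomial.pderiv a (MvPolynomial.pderiv b (MvPolynomial.pderiv c F)) =
      flatConst N a b c := by
  obtain ⟨V, hV⟩ := hF
  have h := hV.product a b
  obtain rfl := hV.eq_flatParam hN
  rw [jacobiReduce, derivative_unfolding_flatParam hN, tangentClass_flatParam,
    tangentClass_flatParam, faber_mul_faber_modByMonic] at h
  simp only [tangentClass_flatParam] at h
  exact (congrFun (faber_sum_injective (flatTime N) h) c).symm

end Uniqueness

/-! ### Power series in two variables -/

section Bivariate

open MvPowerSeries Finset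

/-- The exponent `(i, j)`. -/
def expo (i j : ℕ) : Fin 2 →₀ ℕ := Finsupp.single 0 i + Finsupp.single 1 j

@[simp] lemma expo_zero (i j : ℕ) : expo i j 0 = i := by simp [expo]

@[simp] lemma expo_one (i j : ℕ) : expo i j 1 = j := by simp [expo]

lemma eq_expo (n : Fin 2 →₀ ℕ) : n = expo (n 0) (n 1) := by
  ext k; fin_cases k <;> simp

lemma expo_injective {i j k l : ℕ} : expo i j = expo k l ↔ i = k ∧ j = l := by
  refine ⟨fun h => ⟨?_, ?_⟩, fun h => by rw [h.1, h.2]⟩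
  · simpa using DFunLike.congr_fun h 0
  · simpa using DFunLike.congr_fun h 1

lemma degree_expo (i j : ℕ) : (expo i j).degree = i + j := by
  rw [Finsupp.degree_eq_sum, Fin.sum_univ_two, expo_zero, expo_one]

lemma sum_expo {ι : Type*} (s : Finset ι) (f g : ι → ℕ) :
    ∑ k ∈ s, expo (f k) (g k) = expo (∑ k ∈ s, f k) (∑ k ∈ s, g k) := by
  ext k
  rw [Finsupp.finsetSum_apply]
  fin_cases k <;> simp

variable {B : Type*} [CommRing B]

lemma coeff_expo_mul (f g : MvPowerSeries (Fin 2) B) (i j : ℕ) :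
    coeff (expo i j) (f * g) = ∑ a ∈ range (i + 1), ∑ b ∈ range (j + 1),
      coeff (expo a b) f * coeff (expo (i - a) (j - b)) g := by
  classical
  rw [coeff_mul, ← sum_product']
  refine sum_nbij' (fun p => (p.1 0, p.1 1)) (fun p => (expo p.1 p.2, expo (i - p.1) (j - p.2)))
    ?_ ?_ ?_ ?_ ?_
  · intro p hp
    rw [HasAntidiagonal.mem_antidiagonal] at hp
    have h0 := DFunLike.congr_fun hp 0
    have h1 := DFunLike.congr_fun hp 1
    simp only [Finsupp.add_apply, expo_zero, expo_one] at h0 h1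
    simp only [mem_product, Finset.mem_range]
    omega
  · intro p hp
    simp only [mem_product, Finset.mem_range] at hp
    rw [HasAntidiagonal.mem_antidiagonal]
    ext k
    fin_cases k
    · simp; omega
    · simp; omega
  · intro p hp
    rw [HasAntidiagonal.mem_antidiagonal] at hp
    have h0 := DFunLike.congr_fun hp 0
    have h1 := DFunLike.congr_fun hp 1
    simp only [Finsupp.add_apply, expo_zero, expo_one] at h0 h1
    refine Prod.ext (eq_expo _).symm ?_
    rw [eq_expo p.2]
    exact expo_injective.2 ⟨by simp only; omega, by simp only; omega⟩
  · intro p _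
    simp
  · intro p hp
    rw [HasAntidiagonal.mem_antidiagonal] at hp
    have h0 := DFunLike.congr_fun hp 0
    have h1 := DFunLike.congr_fun hp 1
    simp only [Finsupp.add_apply, expo_zero, expo_one] at h0 h1
    rw [← eq_expo p.1, show i - p.1 0 = p.2 0 by omega, show j - p.1 1 = p.2 1 by omega,
      ← eq_expo p.2]

/-- Two series agree up to total degree `s`. -/
def EqUpTo (s : ℕ) (f g : MvPowerSeries (Fin 2) B) : Prop :=
  ∀ n : Fin 2 →₀ ℕ, n.degree ≤ s → coeff n f = coeff n g

lemma EqUpTo.mul {s : ℕ} {f f' g g' : MvPowerSeries (Fin 2) B} (hf : EqUpTo s f f')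
    (hg : EqUpTo s g g') : EqUpTo s (f * g) (f' * g') := by
  classical
  intro n hn
  rw [coeff_mul, coeff_mul]
  refine sum_congr rfl fun p hp => ?_
  have h := congrArg Finsupp.degree (HasAntidiagonal.mem_antidiagonal.1 hp)
  rw [map_add] at h
  rw [hf _ (by omega), hg _ (by omega)]

lemma EqUpTo.pow {s : ℕ} {f g : MvPowerSeries (Fin 2) B} (h : EqUpTo s f g) (m : ℕ) :
    EqUpTo s (f ^ m) (g ^ m) := by
  induction m with
  | zero => rw [pow_zero, pow_zero]; exact fun _ _ => rfl
  | succ m ih => rw [pow_succ, pow_succ]; exact ih.mul h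

lemma EqUpTo.of_isUnit_mul {s : ℕ} {u f g : MvPowerSeries (Fin 2) B} (hu : IsUnit u)
    (h : EqUpTo s (u * f) (u * g)) : EqUpTo s f g := by
  obtain ⟨v, hv⟩ := hu.exists_left_inv
  have h1 := EqUpTo.mul (f := v) (f' := v) (fun _ _ => rfl) h
  rwa [← mul_assoc, ← mul_assoc, hv, one_mul, one_mul] at h1

lemma isUnit_one_add {f : MvPowerSeries (Fin 2) B} (hf : constantCoeff f = 0) :
    IsUnit (1 + f) := by
  rw [MvPowerSeries.isUnit_iff_constantCoeff, map_add, map_one, hf, add_zero]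
  exact isUnit_one

lemma coeff_mul_pow_of_degree_lt {f : MvPowerSeries (Fin 2) B} (hf : constantCoeff f = 0)
    (g : MvPowerSeries (Fin 2) B) {m : ℕ} {n : Fin 2 →₀ ℕ} (h : n.degree < m) :
    coeff n (g * f ^ m) = 0 := by
  classical
  rw [coeff_mul]
  refine sum_eq_zero fun p hp => ?_
  have hp := congrArg Finsupp.degree (HasAntidiagonal.mem_antidiagonal.1 hp)
  rw [map_add] at hp
  rw [coeff_of_lt_order (f := f ^ m), mul_zero]
  refine lt_of_lt_of_le ?_ (le_order_pow_of_constantCoeff_eq_zero m hf)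
  exact_mod_cast (by omega : p.2.degree < m)

lemma coeff_pow_of_degree_lt {f : MvPowerSeries (Fin 2) B} (hf : constantCoeff f = 0) {m : ℕ}
    {n : Fin 2 →₀ ℕ} (h : n.degree < m) : coeff n (f ^ m) = 0 := by
  rw [← one_mul (f ^ m)]
  exact coeff_mul_pow_of_degree_lt hf 1 h

/-- `∑_γ T_γ ∑_{i + j = γ + 1} w₁^i w₂^j`. -/
def pairSeries (T : ℕ+ → B) : MvPowerSeries (Fin 2) B := fun n =>
  if 0 < n 0 ∧ 0 < n 1 then T (n 0 + n 1 - 1).toPNat' else 0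

lemma coeff_pairSeries (T : ℕ+ → B) (n : Fin 2 →₀ ℕ) : coeff n (pairSeries T) =
    if 0 < n 0 ∧ 0 < n 1 then T (n 0 + n 1 - 1).toPNat' else 0 := rfl

lemma constantCoeff_pairSeries (T : ℕ+ → B) : constantCoeff (pairSeries T) = 0 := by
  rw [← coeff_zero_eq_constantCoeff_apply, coeff_pairSeries, if_neg]
  simp

/-- The pairs of positive integers with sum `γ + 1`. -/
def pairs (γ : ℕ+) : Finset (ℕ+ × ℕ+) := (Icc 1 γ ×ˢ Icc 1 γ).filter fun p => p.1 + p.2 = γ + 1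

lemma mem_pairs {γ : ℕ+} {p : ℕ+ × ℕ+} : p ∈ pairs γ ↔ p.1 + p.2 = γ + 1 := by
  rw [pairs, mem_filter, mem_product, mem_Icc, mem_Icc, and_iff_right_iff_imp]
  intro h
  have h' := congrArg PNat.val h
  simp only [PNat.add_coe, PNat.one_coe] at h'
  have h1 := p.1.pos
  have h2 := p.2.pos
  refine ⟨⟨one_le, ?_⟩, one_le, ?_⟩ <;> rw [← PNat.coe_le_coe] <;> omega

lemma pairSeries_single (γ : ℕ+) : pairSeries (Pi.single γ (1 : B)) =
    ∑ p ∈ pairs γ, monomial (expo p.1 p.2) 1 := by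
  classical
  ext n
  rw [coeff_pairSeries, map_sum]
  simp only [coeff_monomial]
  by_cases h : 0 < n 0 ∧ 0 < n 1
  · rw [if_pos h]
    have key : ∀ p ∈ pairs γ, (n = expo p.1 p.2 ↔ p = ((n 0).toPNat', (n 1).toPNat')) := by
      intro p _
      have h1 : n = expo p.1 p.2 ↔ n 0 = p.1 ∧ n 1 = p.2 := by
        conv_lhs => rw [eq_expo n]
        exact expo_injective
      rw [h1, Prod.ext_iff, ← PNat.coe_inj, ← PNat.coe_inj, Nat.toPNat'_coe, Nat.toPNat'_coe,
        if_pos h.1, if_pos h.2, eq_comm, eq_comm (a := n 1)]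
    rw [sum_congr rfl fun p hp => if_congr (key p hp) rfl rfl, sum_ite_eq', Pi.single_apply]
    refine if_congr ?_ rfl rfl
    rw [mem_pairs, ← PNat.coe_inj, ← PNat.coe_inj]
    simp only [PNat.add_coe, Nat.toPNat'_coe, if_pos h.1, if_pos h.2, PNat.one_coe]
    rw [if_pos (by omega)]
    omega
  · rw [if_neg h, sum_eq_zero]
    intro p _
    rw [if_neg]
    rintro rfl
    exact h ⟨by simp, by simp⟩

/-- Expanding the product chooses from the $k$-th factor a monomial $w_1^{i_k}w_2^{j_k}$ with
$i_k+j_k=\gamma_k+1$; these choices are exactly what `partitionCount` counts. -/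
lemma coeff_prod_pairSeries_single {m : ℕ} (γ : Fin m → ℕ+) (i j : ℕ+) :
    coeff (expo i j) (∏ k, pairSeries (Pi.single (γ k) (1 : B))) = (partitionCount i j γ : B) := by
  classical
  simp only [pairSeries_single]
  rw [prod_univ_sum, map_sum]
  simp only [prod_monomial, prod_const_one, coeff_monomial, sum_expo, expo_injective]
  rw [sum_boole, partitionCount]
  congr 1
  have h : ∀ c : Fin m → ℕ+ × ℕ+,
      c ∈ (Fintype.piFinset fun k => pairs (γ k)).filter
        (fun c => (i : ℕ) = ∑ k, ((c k).1 : ℕ) ∧ (j : ℕ) = ∑ k, ((c k).2 : ℕ)) ↔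
      ∑ k, ((Equiv.arrowProdEquivProdArrow (Fin m) (fun _ => ℕ+) (fun _ => ℕ+) c).1 k : ℕ) = i ∧
      ∑ k, ((Equiv.arrowProdEquivProdArrow (Fin m) (fun _ => ℕ+) (fun _ => ℕ+) c).2 k : ℕ) = j ∧
      ∀ k, (Equiv.arrowProdEquivProdArrow (Fin m) (fun _ => ℕ+) (fun _ => ℕ+) c).1 k +
        (Equiv.arrowProdEquivProdArrow (Fin m) (fun _ => ℕ+) (fun _ => ℕ+) c).2 k = γ k + 1 := by
    intro c
    rw [mem_filter, Fintype.mem_piFinset]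
    simp only [mem_pairs, Equiv.arrowProdEquivProdArrow_apply]
    rw [and_comm, and_assoc, eq_comm, eq_comm (a := (j : ℕ))]
  rw [← Nat.card_congr (Equiv.subtypeEquiv (Equiv.arrowProdEquivProdArrow (Fin m) _ _) h),
    Nat.card_eq_fintype_card, Fintype.card_coe]

lemma partitionCount_eq_zero {m : ℕ} {γ : Fin m → ℕ+} {i j : ℕ+}
    (h : ∑ k, (γ k : ℕ) + m ≠ i + j) : partitionCount i j γ = 0 := by
  rw [partitionCount]
  refine @Nat.card_of_isEmpty _ ⟨?_⟩
  rintro ⟨p, h1, h2, h3⟩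
  refine h ?_
  rw [← h1, ← h2, ← sum_add_distrib]
  have h4 : ∀ k, (p.1 k : ℕ) + p.2 k = γ k + 1 := fun k => congrArg PNat.val (h3 k)
  simp [h4, sum_add_distrib]

lemma eqUpTo_pairSeries (T : ℕ+ → B) (s : ℕ+) :
    EqUpTo s (pairSeries T) (∑ γ ∈ Icc 1 s, C (T γ) * pairSeries (Pi.single γ 1)) := by
  intro n hn
  rw [map_sum]
  simp only [coeff_C_mul, coeff_pairSeries]
  split_ifs with h
  · rw [Finsupp.degree_eq_sum, Fin.sum_univ_two] at hn
    simp only [Pi.single_apply, mul_ite, mul_one, mul_zero]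
    rw [sum_ite_eq, if_pos]
    rw [mem_Icc, ← PNat.coe_le_coe, ← PNat.coe_le_coe, Nat.toPNat'_coe, if_pos (by omega)]
    simp only [PNat.one_coe]
    omega
  · simp

lemma coeff_pairSeries_pow (T : ℕ+ → B) (i j : ℕ+) (m : ℕ) :
    coeff (expo i j) (pairSeries T ^ m) =
      ∑ γ ∈ tuples (i + j) m, (partitionCount i j γ : B) * ∏ k, T (γ k) := by
  classical
  rw [(eqUpTo_pairSeries T (i + j)).pow m _ (by rw [degree_expo, PNat.add_coe]), ← Fin.prod_const,
    prod_univ_sum, map_sum, tuples, sum_filter]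
  refine sum_congr rfl fun γ _ => ?_
  rw [prod_mul_distrib, ← map_prod, coeff_C_mul, coeff_prod_pairSeries_single]
  split_ifs with h
  · rw [mul_comm]
  · rw [partitionCount_eq_zero h, Nat.cast_zero, mul_zero]

/-! ### Truncated logarithms and derivations acting on coefficients. -/

variable [Algebra ℂ B]

/-- The truncated logarithm of `1 + f`. -/
def logTrunc (M : ℕ) (f : MvPowerSeries (Fin 2) B) : MvPowerSeries (Fin 2) B :=
  ∑ m ∈ Icc 1 M, ((-1 : ℂ) ^ (m - 1) / (m : ℂ)) • f ^ m

lemma coeff_complex_smul (a : ℂ) (f : MvPowerSeries (Fin 2) B) (n : Fin 2 →₀ ℕ) :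
    coeff n (a • f) = a • coeff n f := rfl

lemma coeff_logTrunc_pairSeries (T : ℕ+ → B) (M : ℕ) (i j : ℕ+) :
    coeff (expo i j) (logTrunc M (pairSeries T)) = ∑ m ∈ Icc 1 M, ∑ γ ∈ tuples (i + j) m,
      ((-1 : ℂ) ^ (m - 1) / (m : ℂ) * (partitionCount i j γ : ℂ)) • ∏ k, T (γ k) := by
  rw [logTrunc, map_sum]
  refine sum_congr rfl fun m _ => ?_
  rw [coeff_complex_smul, coeff_pairSeries_pow, smul_sum]
  refine sum_congr rfl fun γ _ => ?_
  rw [mul_smul, Nat.cast_smul_eq_nsmul, nsmul_eq_mul]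

/-- The derivation `d` applied to the coefficients. -/
def coeffMap (d : Derivation ℂ B B) : MvPowerSeries (Fin 2) B →ₗ[ℂ] MvPowerSeries (Fin 2) B where
  toFun f := fun n => d (coeff n f)
  map_add' f g := by ext n; exact d.map_add _ _
  map_smul' a f := by ext n; exact d.map_smul a _

lemma coeff_coeffMap (d : Derivation ℂ B B) (f : MvPowerSeries (Fin 2) B) (n : Fin 2 →₀ ℕ) :
    coeff n (coeffMap d f) = d (coeff n f) := rfl

lemma coeffMap_mul (d : Derivation ℂ B B) (f g : MvPowerSeries (Fin 2) B) :
    coeffMap d (f * g) = coeffMap d f * g + f * coeffMap d g := by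
  classical
  ext n
  rw [coeff_coeffMap, map_add, coeff_mul, coeff_mul, coeff_mul, map_sum, ← sum_add_distrib]
  refine sum_congr rfl fun p _ => ?_
  rw [Derivation.leibniz, coeff_coeffMap, coeff_coeffMap, smul_eq_mul, smul_eq_mul]
  ring

lemma coeffMap_pow (d : Derivation ℂ B B) (f : MvPowerSeries (Fin 2) B) (m : ℕ) :
    coeffMap d (f ^ m) = (m : MvPowerSeries (Fin 2) B) * f ^ (m - 1) * coeffMap d f := by
  induction m with
  | zero =>
    rw [pow_zero, Nat.cast_zero, zero_mul, zero_mul]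
    classical
    ext n
    rw [coeff_coeffMap, coeff_one, apply_ite d, d.map_one_eq_zero, map_zero, ite_self, map_zero]
  | succ m ih =>
    rw [pow_succ, coeffMap_mul, ih, Nat.add_sub_cancel]
    rcases m with _ | m
    · simp
    · rw [Nat.add_sub_cancel]; push_cast; ring

lemma coeffMap_pairSeries (d : Derivation ℂ B B) (T : ℕ+ → B) :
    coeffMap d (pairSeries T) = pairSeries fun γ => d (T γ) := by
  ext n
  rw [coeff_coeffMap, coeff_pairSeries, coeff_pairSeries, apply_ite d, d.map_zero]

/-- The logarithmic derivative. -/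
lemma one_add_mul_coeffMap_logTrunc (d : Derivation ℂ B B) (M : ℕ)
    (f : MvPowerSeries (Fin 2) B) :
    (1 + f) * coeffMap d (logTrunc M f) = coeffMap d f - coeffMap d f * (-1) ^ M * f ^ M := by
  induction M with
  | zero => simp [logTrunc]
  | succ M ih =>
    have h : logTrunc (M + 1) f =
        logTrunc M f + ((-1 : ℂ) ^ M / ((M + 1 : ℕ) : ℂ)) • f ^ (M + 1) := by
      rw [logTrunc, sum_Icc_succ_top (by omega), Nat.add_sub_cancel]; rfl
    have h2 : ((-1 : ℂ) ^ M / ((M + 1 : ℕ) : ℂ)) •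
        (((M + 1 : ℕ) : MvPowerSeries (Fin 2) B) * f ^ M * coeffMap d f) =
        (-1) ^ M * f ^ M * coeffMap d f := by
      rw [mul_assoc, ← nsmul_eq_mul, ← Nat.cast_smul_eq_nsmul ℂ, smul_smul,
        div_mul_cancel₀ _ (Nat.cast_ne_zero.2 (Nat.succ_ne_zero M)), mul_assoc, Algebra.smul_def,
        map_pow, map_neg, map_one]
    rw [h, map_add, map_smul, coeffMap_pow, Nat.add_sub_cancel, h2, mul_add, ih]
    ring

end Bivariate

/-! ### The coefficients of the hierarchy of type `A` -/

section Coefficients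

open Finset

variable {N : ℕ}

/-- `(x(z₁) - x(z₂)) / (z₁ - z₂) - 1` in flat coordinates. -/
def flatPair (N : ℕ) : MvPowerSeries (Fin 2) (MvPolynomial (Fin N) ℂ) :=
  pairSeries fun γ => flatTime N γ.natPred

lemma coeff_flatPair_succ (i j : ℕ) :
    MvPowerSeries.coeff (expo (i + 1) (j + 1)) (flatPair N) = flatTime N (i + j) := by
  rw [flatPair, coeff_pairSeries, expo_zero, expo_one, if_pos ⟨i.succ_pos, j.succ_pos⟩]
  congr 1
  have : (i + 1 + (j + 1) - 1) = (i + j) + 1 := by omega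
  rw [this]
  rfl

lemma coeff_flatPair_zero_left (j : ℕ) : MvPowerSeries.coeff (expo 0 j) (flatPair N) = 0 := by
  rw [flatPair, coeff_pairSeries, expo_zero, if_neg (by omega)]

lemma coeff_flatPair_zero_right (i : ℕ) : MvPowerSeries.coeff (expo i 0) (flatPair N) = 0 := by
  rw [flatPair, coeff_pairSeries, expo_one, if_neg (by omega)]

lemma constantCoeff_flatPair : MvPowerSeries.constantCoeff (flatPair N) = 0 :=
  constantCoeff_pairSeries _

lemma coeffMap_flatPair (c : Fin N) : coeffMap (MvPolynomial.pderiv (Fin.rev c)) (flatPair N) =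
    pairSeries (Pi.single (Nat.succPNat c) 1) := by
  rw [flatPair, coeffMap_pairSeries]
  congr 1
  funext γ
  rw [pderiv_flatTime, Fin.rev_rev, Pi.single_apply]
  refine if_congr ?_ rfl rfl
  refine ⟨fun h => ?_, fun h => ?_⟩
  · rw [← h, PNat.succPNat_natPred]
  · rw [h, Nat.natPred_succPNat]

open Polynomial in
/-- The series `∑_(i,j) φ_i φ_j w₁^i w₂^j`. -/
def faberPair (N : ℕ) : MvPowerSeries (Fin 2) (MvPolynomial (Fin N) ℂ)[X] :=
  fun n => faber (flatTime N) (n 0) * faber (flatTime N) (n 1)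

lemma coeff_faberPair (i j : ℕ) : MvPowerSeries.coeff (expo i j) (faberPair N) =
    faber (flatTime N) i * faber (flatTime N) j := by
  change faber (flatTime N) (expo i j 0) * faber (flatTime N) (expo i j 1) = _
  rw [expo_zero, expo_one]

open Polynomial in
-- The identity `faber_mul_faber` in generating form: multiplication by $1+P$ replaces
-- $\varphi_i\varphi_j$ by $\varphi_{i+j-1}$.
lemma flatPair_mul_faberPair (n : Fin 2 →₀ ℕ) :
    MvPowerSeries.coeff n ((1 + MvPowerSeries.map (C : MvPolynomial (Fin N) ℂ →+* _) (flatPair N)) *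
      faberPair N) =
      if 0 < n 0 ∧ 0 < n 1 then faber (flatTime N) (n 0 + n 1 - 1) else 0 := by
  obtain ⟨i, j, rfl⟩ : ∃ i j, n = expo i j := ⟨_, _, eq_expo n⟩
  rw [expo_zero, expo_one, add_mul, one_mul, map_add, coeff_expo_mul, coeff_faberPair]
  simp only [MvPowerSeries.coeff_map, coeff_faberPair]
  rcases i with _ | i
  · simp
  rcases j with _ | j
  · simp
  rw [if_pos ⟨i.succ_pos, j.succ_pos⟩, sum_range_succ']
  simp only [coeff_flatPair_zero_left, map_zero, zero_mul, sum_const_zero, add_zero]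
  have h : ∀ a, ∑ b ∈ range (j + 1 + 1),
      C (MvPowerSeries.coeff (expo (a + 1) b) (flatPair N)) *
        (faber (flatTime N) (i + 1 - (a + 1)) * faber (flatTime N) (j + 1 - b)) =
      ∑ b ∈ range (j + 1), C (flatTime N (a + b)) *
        (faber (flatTime N) (i - a) * faber (flatTime N) (j - b)) := by
    intro a
    rw [sum_range_succ', coeff_flatPair_zero_right, map_zero, zero_mul, add_zero]
    refine sum_congr rfl fun b _ => ?_
    rw [coeff_flatPair_succ, Nat.add_sub_add_right, Nat.add_sub_add_right]
  simp only [h]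
  rw [faber_mul_faber]
  congr 1
  omega

open Polynomial in
-- Multiply both generating series by the unit $1+P$. On the right
-- $(1+P)\,\partial_c\log(1+P)=\partial_cP$ is the sum of $w_1^kw_2^l$ with $k+l-2$ the index paired
-- with $c$; summed against the Faber polynomials this gives $\varphi_{k+l-1}$. The bound $i+j\le
-- N+1$ ensures that every index needed occurs among the $N$ coordinates.
lemma faber_mul_faber_eq_sum_pderiv_logTrunc (i j : ℕ+) (M : ℕ) (hM : (i : ℕ) + j ≤ M)
    (hN : (i : ℕ) + j ≤ N + 1) :
    faber (flatTime N) i * faber (flatTime N) j = ∑ c : Fin N,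
      C (MvPolynomial.pderiv c (MvPowerSeries.coeff (expo i j) (logTrunc M (flatPair N)))) *
        faber (flatTime N) (Fin.rev c + 1) := by
  set H : MvPowerSeries (Fin 2) (MvPolynomial (Fin N) ℂ)[X] :=
    ∑ c : Fin N, MvPowerSeries.C (faber (flatTime N) (Fin.rev c + 1)) *
      MvPowerSeries.map (C : MvPolynomial (Fin N) ℂ →+* _)
        (coeffMap (MvPolynomial.pderiv c) (logTrunc M (flatPair N))) with hH
  set U := 1 + MvPowerSeries.map (C : MvPolynomial (Fin N) ℂ →+* _) (flatPair N) with hU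
  have hUH : U * H = ∑ c : Fin N, MvPowerSeries.C (faber (flatTime N) (Fin.rev c + 1)) *
      MvPowerSeries.map (C : MvPolynomial (Fin N) ℂ →+* _)
        (coeffMap (MvPolynomial.pderiv c) (flatPair N) -
          coeffMap (MvPolynomial.pderiv c) (flatPair N) * (-1) ^ M * (flatPair N) ^ M) := by
    rw [hH, mul_sum]
    refine sum_congr rfl fun c _ => ?_
    rw [← one_add_mul_coeffMap_logTrunc, map_mul, map_add, map_one, ← hU]
    ring
  have hu : IsUnit U := by
    refine isUnit_one_add ?_
    rw [MvPowerSeries.constantCoeff_map, constantCoeff_flatPair, map_zero]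
  have key : EqUpTo (i + j) (faberPair N) H := by
    refine EqUpTo.of_isUnit_mul hu fun n hn => ?_
    rw [hUH, flatPair_mul_faberPair, map_sum]
    have h1 : ∀ c : Fin N, MvPowerSeries.coeff n
        (MvPowerSeries.C (faber (flatTime N) (Fin.rev c + 1)) *
          MvPowerSeries.map (C : MvPolynomial (Fin N) ℂ →+* _)
          (coeffMap (MvPolynomial.pderiv c) (flatPair N) -
            coeffMap (MvPolynomial.pderiv c) (flatPair N) * (-1) ^ M * (flatPair N) ^ M)) =
        if 0 < n 0 ∧ 0 < n 1 then
          if n 0 + n 1 - 2 = Fin.rev c then faber (flatTime N) (Fin.rev c + 1) else 0 else 0 := by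
      intro c
      rw [MvPowerSeries.coeff_C_mul, MvPowerSeries.coeff_map, map_sub, map_sub]
      have h2 : MvPowerSeries.coeff n (coeffMap (MvPolynomial.pderiv c) (flatPair N) *
          (-1) ^ M * (flatPair N) ^ M) = 0 := by
        rcases hn.lt_or_eq with hlt | heq
        · exact coeff_mul_pow_of_degree_lt constantCoeff_flatPair _ (by omega)
        -- In the top degree $i+j$, which may equal $M$, the factor $P^M$ is not enough; the missing
        -- order comes from $\partial_cP$, whose constant term is zero.
        · have h3 : coeffMap (MvPolynomial.pderiv c) (flatPair N) * (-1) ^ M * (flatPair N) ^ M =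
              (-1) ^ M * coeffMap (MvPolynomial.pderiv c) (flatPair N) * (flatPair N) ^ M := by
            ring
          have h4 : MvPowerSeries.constantCoeff
              (coeffMap (MvPolynomial.pderiv c) (flatPair N)) = 0 := by
            rw [flatPair, coeffMap_pairSeries, constantCoeff_pairSeries]
          rw [h3, mul_assoc]
          refine MvPowerSeries.coeff_of_lt_order (lt_of_lt_of_le ?_ MvPowerSeries.le_order_mul)
          refine lt_of_lt_of_le ?_ (le_add_left MvPowerSeries.le_order_mul)
          refine lt_of_lt_of_le ?_ (add_le_add
            (MvPowerSeries.one_le_order_iff_constCoeff_eq_zero.2 h4)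
            (MvPowerSeries.le_order_pow_of_constantCoeff_eq_zero M constantCoeff_flatPair))
          exact_mod_cast (by omega : n.degree < 1 + M)
      rw [h2, map_zero, sub_zero, flatPair, coeffMap_pairSeries, coeff_pairSeries]
      split_ifs with h h'
      · rw [pderiv_flatTime, if_pos, map_one, mul_one]
        rw [← h', PNat.natPred, Nat.toPNat'_coe, if_pos (by omega)]
        omega
      · rw [pderiv_flatTime, if_neg, map_zero, mul_zero]
        rw [PNat.natPred, Nat.toPNat'_coe, if_pos (by omega)]
        omega
      · rw [map_zero, mul_zero]
    rw [sum_congr rfl fun c _ => h1 c]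
    split_ifs with h
    · rw [Finsupp.degree_eq_sum, Fin.sum_univ_two] at hn
      have hlt : n 0 + n 1 - 2 < N := by omega
      rw [sum_eq_single (Fin.rev ⟨n 0 + n 1 - 2, hlt⟩)]
      · rw [Fin.rev_rev, if_pos rfl]
        congr 1
        simp only
        omega
      · intro c _ hc
        rw [if_neg]
        intro h'
        refine hc ?_
        rw [← Fin.rev_rev c]
        congr 1
        exact Fin.ext h'.symm
      · simp
    · rw [sum_const_zero]
  have h := key (expo i j) (by rw [degree_expo])
  rw [← coeff_faberPair, h, hH, map_sum]
  refine sum_congr rfl fun c _ => ?_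
  rw [MvPowerSeries.coeff_C_mul, MvPowerSeries.coeff_map, coeff_coeffMap, mul_comm]

/-- The iterated derivative `∏_c ∂/∂t_(N+1-c)`, applied to the coefficients. -/
def iterCoeffMap : List (Fin N) → MvPowerSeries (Fin 2) (MvPolynomial (Fin N) ℂ) →ₗ[ℂ]
    MvPowerSeries (Fin 2) (MvPolynomial (Fin N) ℂ)
  | [] => LinearMap.id
  | c :: l => coeffMap (MvPolynomial.pderiv (Fin.rev c)) ∘ₗ iterCoeffMap l

lemma coeff_iterCoeffMap (l : List (Fin N)) (f : MvPowerSeries (Fin 2) (MvPolynomial (Fin N) ℂ))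
    (n : Fin 2 →₀ ℕ) : MvPowerSeries.coeff n (iterCoeffMap l f) =
      l.foldr (fun c G => MvPolynomial.pderiv (Fin.rev c) G) (MvPowerSeries.coeff n f) := by
  induction l with
  | nil => rfl
  | cons c l ih => rw [List.foldr_cons, ← ih]; rfl

lemma coeffMap_coeffMap_flatPair (a c : Fin N) :
    coeffMap (MvPolynomial.pderiv a)
      (coeffMap (MvPolynomial.pderiv (Fin.rev c)) (flatPair N)) = 0 := by
  rw [coeffMap_flatPair, coeffMap_pairSeries]
  ext1 n
  rw [coeff_pairSeries, Pi.single_apply, (MvPowerSeries.coeff n).map_zero]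
  split_ifs <;> simp

lemma coeffMap_list_prod_eq_zero (a : Fin N) (l : List (Fin N)) :
    coeffMap (MvPolynomial.pderiv a)
      (l.map fun c => coeffMap (MvPolynomial.pderiv (Fin.rev c)) (flatPair N)).prod = 0 := by
  induction l with
  | nil => simpa using coeffMap_pow (MvPolynomial.pderiv a) (flatPair N) 0
  | cons c l ih =>
    rw [List.map_cons, List.prod_cons, coeffMap_mul, ih, coeffMap_coeffMap_flatPair, zero_mul,
      mul_zero, add_zero]

/-- $P$ is linear in $t$, so its first derivatives are constants and each further differentiation
only lowers the power of $P$. -/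
lemma iterCoeffMap_flatPair_pow (l : List (Fin N)) (m : ℕ) :
    iterCoeffMap l (flatPair N ^ m) = m.descFactorial l.length • (flatPair N ^ (m - l.length) *
      (l.map fun c => coeffMap (MvPolynomial.pderiv (Fin.rev c)) (flatPair N)).prod) := by
  induction l with
  | nil => simp [iterCoeffMap]
  | cons c l ih =>
    rw [iterCoeffMap, LinearMap.comp_apply, ih, map_nsmul, coeffMap_mul, coeffMap_list_prod_eq_zero, mul_zero, add_zero, coeffMap_pow,
      List.length_cons, Nat.descFactorial_succ, List.map_cons, List.prod_cons, Nat.sub_sub,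
      nsmul_eq_mul, nsmul_eq_mul]
    push_cast
    ring

/-- Too low a power is annihilated by the derivatives; too high a power leaves a factor $P$, which
vanishes at $t=0$. -/
lemma constantCoeff_coeff_iterCoeffMap (l : List (Fin N)) (m : ℕ) (n : Fin 2 →₀ ℕ) :
    MvPolynomial.constantCoeff (MvPowerSeries.coeff n (iterCoeffMap l (flatPair N ^ m))) =
      if m = l.length then (m.factorial : ℂ) * MvPolynomial.constantCoeff (MvPowerSeries.coeff n
        (l.map fun c => coeffMap (MvPolynomial.pderiv (Fin.rev c)) (flatPair N)).prod) else 0 := by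
  rw [iterCoeffMap_flatPair_pow, map_nsmul, map_nsmul, nsmul_eq_mul]
  rcases lt_trichotomy m l.length with h | h | h
  · rw [if_neg h.ne, Nat.descFactorial_eq_zero_iff_lt.2 h, Nat.cast_zero, zero_mul]
  · rw [if_pos h, ← h, Nat.descFactorial_self, Nat.sub_self, pow_zero, one_mul]
  · rw [if_neg h.ne']
    have hz : MvPowerSeries.map (MvPolynomial.constantCoeff (R := ℂ)) (flatPair N) = 0 := by
      ext1 k
      rw [MvPowerSeries.coeff_map, flatPair, coeff_pairSeries, (MvPowerSeries.coeff k).map_zero]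
      rw [flatTime]
      split_ifs <;> simp
    rw [← MvPowerSeries.coeff_map, map_mul, map_pow, hz, zero_pow (by omega), zero_mul, map_zero,
      mul_zero]

lemma foldr_pderiv_congr {p q : MvPolynomial (Fin N) ℂ}
    (h : ∀ c, MvPolynomial.pderiv c p = MvPolynomial.pderiv c q) {l : List (Fin N)} (hl : l ≠ []) :
    l.foldr (fun c G => MvPolynomial.pderiv (Fin.rev c) G) p =
      l.foldr (fun c G => MvPolynomial.pderiv (Fin.rev c) G) q := by
  induction l with
  | nil => exact absurd rfl hl
  | cons c l ih =>
    rw [List.foldr_cons, List.foldr_cons]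
    rcases eq_or_ne l [] with rfl | hl
    · exact h _
    · rw [ih hl]

theorem coeffR_eq {F : ∀ N : ℕ, MvPolynomial (Fin N) ℂ}
    (hF : ∀ N : ℕ, 1 ≤ N → IsPotentialA N (F N)) (α β : ℕ+) {m : ℕ} (hm : 1 ≤ m)
    {γ : Fin m → ℕ+} (hγ : γ ∈ tuples (α + β) m) :
    coeffR F α β γ = (-1 : ℂ) ^ (m - 1) / (m : ℂ) * (partitionCount α β γ : ℂ) := by
  have hsum : (∑ i, (γ i : ℕ)) + m = α + β := by
    rw [tuples, mem_filter] at hγ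
    rw [hγ.2, PNat.add_coe]
  have hlt : ∀ i, (γ i : ℕ) - 1 < (α : ℕ) + β + 1 := by
    intro i
    have := single_le_sum (f := fun i => (γ i : ℕ)) (fun _ _ => Nat.zero_le _) (mem_univ i)
    omega
  have hα := α.pos
  have hβ := β.pos
  set N := (α : ℕ) + β + 1 with hN
  set a : Fin N := ⟨(α : ℕ) - 1, by omega⟩ with ha
  set b : Fin N := ⟨(β : ℕ) - 1, by omega⟩ with hb
  set c : Fin m → Fin N := fun i => ⟨(γ i : ℕ) - 1, hlt i⟩ with hc
  have hR : coeffR F α β γ = potentialCoeff (F N) a b c := by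
    rw [coeffR, dif_pos hlt]
  have ha1 : (a : ℕ) + 1 = α := by rw [ha]; simp only; omega
  have hb1 : (b : ℕ) + 1 = β := by rw [hb]; simp only; omega
  have hderiv : ∀ e : Fin N, MvPolynomial.pderiv e
      (MvPolynomial.pderiv a (MvPolynomial.pderiv b (F N))) = MvPolynomial.pderiv e
      (MvPowerSeries.coeff (expo α β) (logTrunc (α + β) (flatPair N))) := by
    intro e
    rw [(hF N (by omega)).pderiv_eq_flatConst (by omega), flatConst_swap_left,
      flatConst_swap_right]
    refine congrFun (faber_sum_injective (flatTime N) (e := fun e => flatConst N a b e)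
      (e' := fun e => MvPolynomial.pderiv e
        (MvPowerSeries.coeff (expo α β) (logTrunc (α + β) (flatPair N)))) ?_) e
    rw [← faber_mul_faber_eq_sum_pderiv_logTrunc α β (α + β) le_rfl (by omega),
      ← faber_mul_faber_modByMonic, ha1, hb1]
    refine modByMonic_faber_of_degree_lt _ ?_
    refine Polynomial.degree_lt_iff_coeff_zero _ _ |>.2 fun k hk => ?_
    refine Polynomial.coeff_eq_zero_of_natDegree_lt ?_
    refine Polynomial.natDegree_mul_le.trans_lt ?_
    have h1 := Polynomial.natDegree_le_of_degree_le (degree_faber_lt (flatTime N) α).le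
    have h2 := Polynomial.natDegree_le_of_degree_le (degree_faber_lt (flatTime N) β).le
    omega
  -- Only the gradients of $\partial_\alpha\partial_\beta F$ and of the logarithm have been
  -- compared, so at least one further derivative is needed; this is where $m\ge1$ enters.
  have hl : List.ofFn c ≠ [] := by
    rw [Ne, List.ofFn_eq_nil_iff]; omega
  have hE : ((List.ofFn c).map fun e =>
      coeffMap (MvPolynomial.pderiv (Fin.rev e)) (flatPair N)).prod =
      ∏ k, pairSeries (Pi.single (γ k) (1 : MvPolynomial (Fin N) ℂ)) := by
    rw [List.map_ofFn, List.prod_ofFn]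
    refine prod_congr rfl fun k _ => ?_
    rw [Function.comp_apply, coeffMap_flatPair]
    congr 2
    exact PNat.succPNat_natPred (γ k)
  rw [hR, potentialCoeff, foldr_pderiv_congr hderiv hl, ← coeff_iterCoeffMap, logTrunc, map_sum,
    map_sum, map_sum, sum_eq_single m]
  · rw [map_smul, coeff_complex_smul, MvPolynomial.constantCoeff_smul,
      constantCoeff_coeff_iterCoeffMap, if_pos (List.length_ofFn).symm, hE,
      coeff_prod_pairSeries_single, map_natCast, smul_eq_mul]
    have : (m.factorial : ℂ) ≠ 0 := Nat.cast_ne_zero.2 m.factorial_ne_zero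
    field_simp
  · intro k _ hk
    rw [map_smul, coeff_complex_smul, MvPolynomial.constantCoeff_smul,
      constantCoeff_coeff_iterCoeffMap, if_neg, smul_zero]
    rwa [List.length_ofFn]
  · intro h
    exact absurd (mem_Icc.2 ⟨hm, by omega⟩) h

end Coefficients

/-! ### The change of variables -/

section ChangeOfVariables

open Finset

variable {K : Type*} [CommRing K] [Algebra ℂ K]

lemma partialD_changeVars (k : ℕ+) (f : MvPowerSeries ℕ+ K) :
    partialD K k (changeVars f) =
      changeVars ((algebraMap ℂ K (1 / ((k : ℕ) : ℂ)) • partialD K k) f) := by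
  ext n
  rw [LinearMap.smul_apply, changeVars, changeVars, MvPowerSeries.coeff_rescale,
    MvPowerSeries.coeff_smul]
  change MvPowerSeries.coeff n (MvPowerSeries.pderiv K k _) =
    _ * (_ * MvPowerSeries.coeff n (MvPowerSeries.pderiv K k f))
  have h1 : (Finsupp.single k 1 : ℕ+ →₀ ℕ).prod
      (fun s m => algebraMap ℂ K (1 / ((s : ℕ) : ℂ)) ^ m) = algebraMap ℂ K (1 / ((k : ℕ) : ℂ)) := by
    simp [Finsupp.prod_single_index]
  have h2 : (n + Finsupp.single k 1 : ℕ+ →₀ ℕ).prod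
      (fun s m => algebraMap ℂ K (1 / ((s : ℕ) : ℂ)) ^ m) =
        n.prod (fun s m => algebraMap ℂ K (1 / ((s : ℕ) : ℂ)) ^ m) *
          algebraMap ℂ K (1 / ((k : ℕ) : ℂ)) := by
    rw [Finsupp.prod_add_index' (fun _ => pow_zero _) (fun _ _ _ => pow_add _ _ _), h1]
  rw [MvPowerSeries.coeff_pderiv, MvPowerSeries.coeff_pderiv, MvPowerSeries.coeff_rescale, h2]
  ring

lemma changeVars_injective : Function.Injective (changeVars (K := K)) := by
  refine Function.LeftInverse.injective
    (g := MvPowerSeries.rescale fun k : ℕ+ => algebraMap ℂ K ((k : ℕ) : ℂ)) fun f => ?_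
  rw [changeVars, MvPowerSeries.rescale_rescale]
  have : ((fun k : ℕ+ => algebraMap ℂ K (1 / ((k : ℕ) : ℂ))) *
      fun k : ℕ+ => algebraMap ℂ K ((k : ℕ) : ℂ)) = 1 := by
    funext k
    rw [Pi.mul_apply, ← map_mul, one_div, inv_mul_cancel₀ (Nat.cast_ne_zero.2 k.ne_zero), map_one,
      Pi.one_apply]
  rw [this, MvPowerSeries.rescale_one, RingHom.id_apply]

lemma changeVars_complex_smul (a : ℂ) (f : MvPowerSeries ℕ+ K) :
    changeVars (a • f) = a • changeVars f := by
  ext n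
  change _ = a • MvPowerSeries.coeff n (changeVars f)
  rw [changeVars, changeVars, MvPowerSeries.coeff_rescale, MvPowerSeries.coeff_rescale]
  change _ * (a • MvPowerSeries.coeff n f) = _
  rw [mul_smul_comm]

theorem equationA_changeVars_iff (F : ∀ N : ℕ, MvPolynomial (Fin N) ℂ) (α β : ℕ+)
    (f : MvPowerSeries ℕ+ K) :
    EquationA F (partialD K) α β (changeVars f) ↔ EquationARescaled F (partialD K) α β f := by
  rw [EquationARescaled, EquationA, EquationA]
  simp only [partialD_changeVars]
  have h : ∀ (m : ℕ) (γ : Fin m → ℕ+) (g : Fin m → MvPowerSeries ℕ+ K),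
      coeffR F α β γ • ∏ i, changeVars (g i) = changeVars (coeffR F α β γ • ∏ i, g i) := by
    intro m γ g
    rw [changeVars_complex_smul]
    congr 1
    exact (map_prod _ _ _).symm
  simp only [h]
  have h2 : ∀ (s : Finset ℕ) (g : ∀ m : ℕ, (Fin m → ℕ+) → MvPowerSeries ℕ+ K),
      ∑ m ∈ s, ∑ γ ∈ tuples (α + β) m, changeVars (g m γ) =
        changeVars (∑ m ∈ s, ∑ γ ∈ tuples (α + β) m, g m γ) := by
    intro s g
    simp only [changeVars, map_sum]
  rw [h2]
  exact changeVars_injective.eq_iff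

/-- The common form of both halves of the theorem; the operators are left arbitrary so that it
serves $\frac1k\partial_k$ and $\frac1k\partial_k^\hbar$ alike. -/
lemma equationA_iff {F : ∀ N : ℕ, MvPolynomial (Fin N) ℂ}
    (hF : ∀ N : ℕ, 1 ≤ N → IsPotentialA N (F N))
    (d : ℕ+ → Module.End K (MvPowerSeries ℕ+ K)) (α β : ℕ+) (f : MvPowerSeries ℕ+ K) :
    EquationA F d α β f ↔ d α (d β f) =
      MvPowerSeries.coeff (expo α β) (logTrunc (α + β) (pairSeries fun γ => d 1 (d γ f))) := by
  rw [EquationA, coeff_logTrunc_pairSeries]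
  refine Eq.congr_right (sum_congr rfl fun m hm => sum_congr rfl fun γ hγ => ?_)
  rw [coeffR_eq hF α β (mem_Icc.1 hm).1 hγ]

theorem equationARescaled_iff_equationDKP {F : ∀ N : ℕ, MvPolynomial (Fin N) ℂ}
    (hF : ∀ N : ℕ, 1 ≤ N → IsPotentialA N (F N)) (α β : ℕ+) (f : MvPowerSeries ℕ+ K) :
    EquationARescaled F (partialD K) α β f ↔ EquationDKP α β f := by
  have hα : ((α : ℕ) : ℂ) ≠ 0 := Nat.cast_ne_zero.2 α.ne_zero
  have hβ : ((β : ℕ) : ℂ) ≠ 0 := Nat.cast_ne_zero.2 β.ne_zero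
  rw [EquationARescaled, equationA_iff hF, coeff_logTrunc_pairSeries, EquationDKP]
  simp only [LinearMap.smul_apply, algebraMap_smul, LinearMap.map_smul_of_tower, smul_smul,
    PNat.one_coe, Nat.cast_one, div_one, one_mul, Finset.prod_smul]
  -- Multiplying by $\alpha\beta$ clears the rescaling on the left and produces the factor $ij$ on
  -- the right; the denominators $\gamma_k$ come from the rescaled $\partial_{\gamma_k}$.
  rw [← (smul_right_injective _ (mul_ne_zero hα hβ)).eq_iff]
  simp only [smul_sum, smul_smul]
  rw [show ((α : ℕ) : ℂ) * ((β : ℕ) : ℂ) * (1 / ((α : ℕ) : ℂ) * (1 / ((β : ℕ) : ℂ))) = 1 by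
    field_simp, one_smul]
  refine Eq.congr_right (sum_congr rfl fun m _ => sum_congr rfl fun γ _ => ?_)
  congr 1
  rw [prod_div_distrib, prod_const_one]
  ring

end ChangeOfVariables

/-! ### The Fay identity -/

section Fay

open Finset

variable {B : Type*} [CommRing B] {K : Type*} [CommRing K]

lemma coeff_X_zero_mul_succ (f : MvPowerSeries (Fin 2) B) (i j : ℕ) :
    MvPowerSeries.coeff (expo (i + 1) j) (MvPowerSeries.X 0 * f) =
      MvPowerSeries.coeff (expo i j) f := by
  have : expo (i + 1) j = Finsupp.single 0 1 + expo i j := by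
    rw [expo, expo, add_comm i, Finsupp.single_add, add_assoc]
  rw [this, MvPowerSeries.X_def, MvPowerSeries.coeff_add_monomial_mul, one_mul]

lemma coeff_X_one_mul_succ (f : MvPowerSeries (Fin 2) B) (i j : ℕ) :
    MvPowerSeries.coeff (expo i (j + 1)) (MvPowerSeries.X 1 * f) =
      MvPowerSeries.coeff (expo i j) f := by
  have : expo i (j + 1) = Finsupp.single 1 1 + expo i j := by
    rw [expo, expo, add_comm j, Finsupp.single_add]
    abel
  rw [this, MvPowerSeries.X_def, MvPowerSeries.coeff_add_monomial_mul, one_mul]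

lemma coeff_X_zero_mul_zero (f : MvPowerSeries (Fin 2) B) (j : ℕ) :
    MvPowerSeries.coeff (expo 0 j) (MvPowerSeries.X 0 * f) = 0 := by
  classical
  rw [MvPowerSeries.X_def, MvPowerSeries.coeff_monomial_mul, if_neg]
  intro h
  simpa using h 0

lemma coeff_X_one_mul_zero (f : MvPowerSeries (Fin 2) B) (i : ℕ) :
    MvPowerSeries.coeff (expo i 0) (MvPowerSeries.X 1 * f) = 0 := by
  classical
  rw [MvPowerSeries.X_def, MvPowerSeries.coeff_monomial_mul, if_neg]
  intro h
  simpa using h 1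

lemma ext_expo {f g : MvPowerSeries (Fin 2) B}
    (h : ∀ i j, MvPowerSeries.coeff (expo i j) f = MvPowerSeries.coeff (expo i j) g) : f = g := by
  ext n
  rw [eq_expo n, h]

/-- Since $w_2-w_1$ has unit coefficients, cancellation works by recursion on the exponent of $w_1$,
over coefficient rings that may have zero divisors. -/
lemma X_one_sub_X_zero_mul_cancel {f g : MvPowerSeries (Fin 2) B}
    (h : (MvPowerSeries.X 1 - MvPowerSeries.X 0) * f =
      (MvPowerSeries.X 1 - MvPowerSeries.X 0) * g) : f = g := by
  have h' : ∀ i j, MvPowerSeries.coeff (expo i j) f = MvPowerSeries.coeff (expo i j) g := by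
    intro i
    induction i with
    | zero =>
      intro j
      have := congrArg (MvPowerSeries.coeff (expo 0 (j + 1))) h
      simpa only [sub_mul, map_sub, coeff_X_one_mul_succ, coeff_X_zero_mul_zero, sub_zero] using this
    | succ i ih =>
      intro j
      have := congrArg (MvPowerSeries.coeff (expo (i + 1) (j + 1))) h
      simpa only [sub_mul, map_sub, coeff_X_one_mul_succ, coeff_X_zero_mul_succ, ih, sub_left_inj]
        using this
  exact ext_expo h'

lemma coeff_pairSeries_expo (T : ℕ+ → B) (i j : ℕ) :
    MvPowerSeries.coeff (expo i j) (pairSeries T) =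
      if 0 < i ∧ 0 < j then T (i + j - 1).toPNat' else 0 := by
  rw [coeff_pairSeries, expo_zero, expo_one]

lemma commute_partialD (j k : ℕ+) : Commute (partialD K j) (partialD K k) := by
  refine LinearMap.ext fun f => ?_
  ext n
  change MvPowerSeries.coeff n (MvPowerSeries.pderiv K j (MvPowerSeries.pderiv K k f)) =
    MvPowerSeries.coeff n (MvPowerSeries.pderiv K k (MvPowerSeries.pderiv K j f))
  simp only [MvPowerSeries.coeff_pderiv, Finsupp.add_apply, add_right_comm n]
  rcases eq_or_ne j k with rfl | h
  · rfl
  · rw [Finsupp.single_eq_of_ne h, Finsupp.single_eq_of_ne h.symm, add_zero, add_zero]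
    ring

lemma coeff_mul_pairSeries_eq_zero (T : ℕ+ → B) (g : MvPowerSeries (Fin 2) B) {i j : ℕ}
    (h : i = 0 ∨ j = 0) : MvPowerSeries.coeff (expo i j) (g * pairSeries T) = 0 := by
  rw [coeff_expo_mul]
  refine sum_eq_zero fun a _ => sum_eq_zero fun b _ => ?_
  rw [coeff_pairSeries_expo, if_neg (by omega), mul_zero]

/-! ### Exponential and logarithm as mutually inverse series. -/

variable [Algebra ℂ B] [Algebra ℂ K]

open PowerSeries in
lemma log_subst_exp_sub_one : (log ℂ).subst (exp ℂ - 1) = (X : PowerSeries ℂ) := by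
  have h1 : (mk fun n => algebraMap ℚ ℂ ((-1 : ℚ) ^ n)) * (1 + X) = (1 : PowerSeries ℂ) := by
    ext n
    cases n with
    | zero => simp [mul_add]
    | succ n =>
      rw [mul_add, mul_one, map_add, coeff_succ_mul_X, coeff_mk, coeff_mk, coeff_one,
        if_neg n.succ_ne_zero, pow_succ]
      simp
  refine derivative.ext ?_ ?_
  · rw [derivative_subst HasSubst.exp_sub_one, deriv_log, map_sub, derivative_exp]
    have h2 := congrArg (subst (exp ℂ - 1)) h1
    rw [subst_mul HasSubst.exp_sub_one, subst_add HasSubst.exp_sub_one,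
      subst_X HasSubst.exp_sub_one] at h2
    have h3 : subst (exp ℂ - 1) (1 : PowerSeries ℂ) = (1 : PowerSeries ℂ) := by
      rw [← coe_substAlgHom HasSubst.exp_sub_one, map_one]
    rw [h3, add_sub_cancel] at h2
    simpa using h2
  · rw [constantCoeff_X]
    exact constantCoeff_subst_eq_zero (by simp [← constantCoeff_eq]) _ constantCoeff_log

open PowerSeries in
-- With $G=1/(1+X)$, the derivative of $\log(1+X)$, the product $e^{\log(1+X)}G$ has derivative zero
-- and constant term $1$.
lemma exp_subst_log : (exp ℂ).subst (log ℂ) = (1 + X : PowerSeries ℂ) := by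
  set G : PowerSeries ℂ := d⁄dX ℂ (log ℂ) with hG
  have h1 : G * (1 + X) = 1 := by
    rw [hG, deriv_log]
    ext n
    cases n with
    | zero => simp [mul_add]
    | succ n =>
      rw [mul_add, mul_one, map_add, coeff_succ_mul_X, coeff_mk, coeff_mk, coeff_one,
        if_neg n.succ_ne_zero, pow_succ]
      simp
  have h2 : d⁄dX ℂ G = -G ^ 2 := by
    have h3 := congrArg (d⁄dX ℂ) h1
    rw [Derivation.leibniz, map_add, Derivation.map_one_eq_zero, derivative_X, zero_add,
      smul_eq_mul, smul_eq_mul, mul_one] at h3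
    linear_combination G * h3 - (d⁄dX ℂ G) * h1
  have h3 : (exp ℂ).subst (log ℂ) * G = 1 := by
    refine derivative.ext ?_ ?_
    · rw [Derivation.leibniz, derivative_subst HasSubst.log, derivative_exp, h2,
        Derivation.map_one_eq_zero, ← hG, smul_eq_mul, smul_eq_mul]
      ring
    · rw [map_mul, hG, deriv_log, constantCoeff_mk]
      have h4 : constantCoeff ((exp ℂ - 1).subst (log ℂ) : PowerSeries ℂ) = 0 :=
        constantCoeff_subst_eq_zero (by simp [← constantCoeff_eq]) _ (by simp)
      rw [subst_sub HasSubst.log, map_sub, ← coe_substAlgHom HasSubst.log, map_one, map_one,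
        sub_eq_zero, coe_substAlgHom HasSubst.log] at h4
      rw [h4]
      simp
  linear_combination (1 + X) * h3 - (exp ℂ).subst (log ℂ) * h1

lemma exp_subst_eq_one_add_iff {S Q : MvPowerSeries (Fin 2) B}
    (hS : MvPowerSeries.constantCoeff S = 0) (hQ : MvPowerSeries.constantCoeff Q = 0) :
    (PowerSeries.exp ℂ).subst S = 1 + Q ↔ S = (PowerSeries.log ℂ).subst Q := by
  have hS' : PowerSeries.HasSubst S := PowerSeries.HasSubst.of_constantCoeff_zero hS
  have hQ' : PowerSeries.HasSubst Q := PowerSeries.HasSubst.of_constantCoeff_zero hQ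
  constructor
  · intro h
    have h1 : (PowerSeries.exp ℂ - 1).subst S = Q := by
      rw [PowerSeries.subst_sub hS', h, ← PowerSeries.coe_substAlgHom hS', map_one,
        add_sub_cancel_left]
    rw [← h1, ← PowerSeries.subst_comp_subst_apply PowerSeries.HasSubst.exp_sub_one hS',
      log_subst_exp_sub_one, PowerSeries.subst_X hS']
  · rintro rfl
    rw [← PowerSeries.subst_comp_subst_apply PowerSeries.HasSubst.log hQ', exp_subst_log,
      PowerSeries.subst_add hQ', PowerSeries.subst_X hQ', ← PowerSeries.coe_substAlgHom hQ',
      map_one]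

lemma coeff_log_subst {Q : MvPowerSeries (Fin 2) B} (hQ : MvPowerSeries.constantCoeff Q = 0)
    (n : Fin 2 →₀ ℕ) {M : ℕ} (hM : n.degree ≤ M) :
    MvPowerSeries.coeff n ((PowerSeries.log ℂ).subst Q) =
      MvPowerSeries.coeff n (logTrunc M Q) := by
  rw [PowerSeries.coeff_subst (PowerSeries.HasSubst.of_constantCoeff_zero hQ),
    finsum_eq_sum_of_support_subset (s := Icc 1 M), logTrunc, map_sum]
  · refine sum_congr rfl fun m hm => ?_
    have hm := (mem_Icc.1 hm).1
    rw [coeff_complex_smul, PowerSeries.coeff_log, if_neg (by omega)]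
    congr 1
    obtain ⟨k, rfl⟩ : ∃ k, m = k + 1 := ⟨m - 1, by omega⟩
    rw [Nat.add_sub_cancel, pow_succ, pow_succ]
    simp
  · intro m hm
    rw [coe_Icc, Set.mem_Icc]
    by_contra hc
    refine hm ?_
    rcases Nat.eq_zero_or_pos m with rfl | h
    · simp
    · simp only
      rw [coeff_pow_of_degree_lt hQ (by omega), smul_zero]

/-! ### The operators $\Delta(z)$ and the logarithm of the Fay identity. -/

lemma opDelta_zero (h : K) : opDelta h 0 = 0 := by
  rw [opDelta, Icc_eq_empty (by omega), sum_empty]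

lemma opDelta_one (h : K) : opDelta h 1 = partialD K 1 := by
  rw [opDelta, Icc_self, sum_singleton, pow_one, opD, PowerSeries.coeff_mk, dif_pos one_pos]
  simp

lemma smul_partialH (h : K) (k : ℕ+) :
    algebraMap ℂ K (1 / ((k : ℕ) : ℂ)) • partialH h k = opDelta h k := by
  rw [partialH, smul_smul, ← map_mul, one_div, inv_mul_cancel₀ (Nat.cast_ne_zero.2 k.ne_zero),
    map_one, one_smul]

lemma commute_partialD_opDelta (k : ℕ+) (h : K) (n : ℕ) :
    Commute (partialD K k) (opDelta h n) := by
  have h1 : ∀ n, Commute (partialD K k) (PowerSeries.coeff n (opD K)) := by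
    intro n
    rw [opD, PowerSeries.coeff_mk]
    split_ifs
    · exact (commute_partialD k _).smul_right _
    · exact Commute.zero_right _
  have h2 : ∀ m n, Commute (partialD K k) (PowerSeries.coeff n (opD K ^ m)) := by
    intro m
    induction m with
    | zero =>
      intro n
      rw [pow_zero, PowerSeries.coeff_one]
      split_ifs
      · exact Commute.one_right _
      · exact Commute.zero_right _
    | succ m ih =>
      intro n
      rw [pow_succ, PowerSeries.coeff_mul]
      exact Commute.sum_right _ _ _ fun p _ => (ih _).mul_right (h1 _)
  exact Commute.sum_right _ _ _ fun m _ => (h2 m n).smul_right _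

/-- The unknowns `∂_1 ∂_γ F / γ` of the hierarchy. -/
def fayTime (h : K) (f : MvPowerSeries ℕ+ K) (γ : ℕ+) : MvPowerSeries ℕ+ K :=
  opDelta h 1 (opDelta h γ f)

/-- The Fay identity contains $\Delta_\gamma\partial_1$ and the hierarchy
$\partial_1^\hbar\partial_\gamma^\hbar$; they match because $\partial_1^\hbar=\partial_1$ and the
operators commute. -/
lemma opDelta_partialD_one (h : K) (f : MvPowerSeries ℕ+ K) (γ : ℕ+) :
    opDelta h γ (partialD K 1 f) = fayTime h f γ := by
  rw [fayTime, opDelta_one]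
  exact (LinearMap.congr_fun (commute_partialD_opDelta 1 h γ) f).symm

lemma coeff_deltaDeltaSeries (h : K) (f : MvPowerSeries ℕ+ K) (i j : ℕ) :
    MvPowerSeries.coeff (expo i j) (deltaDeltaSeries h f) = opDelta h i (opDelta h j f) := by
  change opDelta h (expo i j 0) (opDelta h (expo i j 1) f) = _
  rw [expo_zero, expo_one]

lemma coeff_deltaSeries_zero (h : K) (g : MvPowerSeries ℕ+ K) (i j : ℕ) :
    MvPowerSeries.coeff (expo i j) (deltaSeries h 0 g) = if j = 0 then opDelta h i g else 0 := by
  change (if expo i j = Finsupp.single 0 (expo i j 0) then opDelta h (expo i j 0) g else 0) = _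
  rw [expo_zero]
  refine if_congr ?_ rfl rfl
  rw [expo, add_eq_left, Finsupp.single_eq_zero]

lemma coeff_deltaSeries_one (h : K) (g : MvPowerSeries ℕ+ K) (i j : ℕ) :
    MvPowerSeries.coeff (expo i j) (deltaSeries h 1 g) = if i = 0 then opDelta h j g else 0 := by
  change (if expo i j = Finsupp.single 1 (expo i j 1) then opDelta h (expo i j 1) g else 0) = _
  rw [expo_one]
  refine if_congr ?_ rfl rfl
  rw [expo, add_eq_right, Finsupp.single_eq_zero]

/-- The divided difference $-(w_1^k-w_2^k)/(z_1-z_2)=\sum_{i+j=k+1}w_1^iw_2^j$, summed against the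
coefficients of $\Delta\,\partial_1F$. -/
lemma fay_rhs_eq (h : K) (f : MvPowerSeries ℕ+ K) :
    (MvPowerSeries.X 1 - MvPowerSeries.X 0 : MvPowerSeries (Fin 2) (MvPowerSeries ℕ+ K)) -
      MvPowerSeries.X 0 * MvPowerSeries.X 1 *
        (deltaSeries h 0 (partialD K 1 f) - deltaSeries h 1 (partialD K 1 f)) =
      (MvPowerSeries.X 1 - MvPowerSeries.X 0) * (1 + pairSeries (fayTime h f)) := by
  have hΔ : ∀ n, 0 < n → opDelta h n (partialD K 1 f) = fayTime h f n.toPNat' := by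
    intro n hn
    rw [← opDelta_partialD_one, Nat.toPNat'_coe, if_pos hn]
  have key : MvPowerSeries.X 0 * (MvPowerSeries.X 1 *
        (deltaSeries h 0 (partialD K 1 f) - deltaSeries h 1 (partialD K 1 f))) =
      MvPowerSeries.X 0 * pairSeries (fayTime h f) -
        MvPowerSeries.X 1 * pairSeries (fayTime h f) := by
    refine ext_expo fun i j => ?_
    rw [map_sub]
    rcases i with _ | i
    · rcases j with _ | j
      · rw [coeff_X_zero_mul_zero, coeff_X_zero_mul_zero, coeff_X_one_mul_zero, sub_zero]
      · rw [coeff_X_zero_mul_zero, coeff_X_zero_mul_zero, coeff_X_one_mul_succ,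
          coeff_pairSeries_expo, if_neg (by omega), sub_zero]
    · rcases j with _ | j
      · rw [coeff_X_zero_mul_succ, coeff_X_one_mul_zero, coeff_X_zero_mul_succ,
          coeff_X_one_mul_zero, coeff_pairSeries_expo, if_neg (by omega), sub_zero]
      · rw [coeff_X_zero_mul_succ, coeff_X_one_mul_succ, coeff_X_zero_mul_succ,
          coeff_X_one_mul_succ, map_sub, coeff_deltaSeries_zero, coeff_deltaSeries_one,
          coeff_pairSeries_expo, coeff_pairSeries_expo]
        rcases i with _ | i
        · rcases j with _ | j
          · simp
          · rw [if_neg (by omega), if_pos rfl, if_neg (by omega), if_pos (by omega),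
              hΔ _ (by omega)]
            congr 3; omega
        · rcases j with _ | j
          · rw [if_pos rfl, if_neg (by omega), if_pos (by omega), if_neg (by omega),
              hΔ _ (by omega)]
            congr 3
          · rw [if_neg (by omega), if_neg (by omega), if_pos (by omega), if_pos (by omega),
              sub_self, eq_comm, sub_eq_zero]
            congr 2; omega
  linear_combination -key

theorem isKPSolution_iff {F : ∀ N : ℕ, MvPolynomial (Fin N) ℂ}
    (hF : ∀ N : ℕ, 1 ≤ N → IsPotentialA N (F N)) (h : K) (f : MvPowerSeries ℕ+ K) :
    IsKPSolution h f ↔ ∀ α β : ℕ+, EquationARescaled F (partialH h) α β f := by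
  set Q := pairSeries (fayTime h f) with hQdef
  have hQ : MvPowerSeries.constantCoeff Q = 0 := constantCoeff_pairSeries _
  have hS : MvPowerSeries.constantCoeff (deltaDeltaSeries h f) = 0 := by
    have : (0 : Fin 2 →₀ ℕ) = expo 0 0 := by simp [expo]
    rw [← MvPowerSeries.coeff_zero_eq_constantCoeff_apply, this, coeff_deltaDeltaSeries,
      opDelta_zero, LinearMap.zero_apply]
  have h1 : IsKPSolution h f ↔ deltaDeltaSeries h f = (PowerSeries.log ℂ).subst Q := by
    rw [← exp_subst_eq_one_add_iff hS hQ, IsKPSolution]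
    simp only [fay_rhs_eq]
    exact ⟨X_one_sub_X_zero_mul_cancel, fun h => by rw [h]⟩
  have h2 : ∀ α β : ℕ+, EquationARescaled F (partialH h) α β f ↔
      MvPowerSeries.coeff (expo α β) (deltaDeltaSeries h f) =
        MvPowerSeries.coeff (expo α β) ((PowerSeries.log ℂ).subst Q) := by
    intro α β
    rw [EquationARescaled, equationA_iff hF, coeff_deltaDeltaSeries,
      coeff_log_subst hQ _ (degree_expo α β).le]
    simp only [smul_partialH]
    rfl
  rw [h1]
  simp only [h2]
  refine ⟨fun h α β => by rw [h], fun h' => ext_expo fun i j => ?_⟩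
  -- The hierarchy only sees exponents $i,j\ge1$. On the axes both sides vanish: $\Delta$ has no
  -- $z^0$ term, and each term of the pair series is divisible by $w_1w_2$.
  by_cases hij : 0 < i ∧ 0 < j
  · exact h' ⟨i, hij.1⟩ ⟨j, hij.2⟩
  · have hij' : i = 0 ∨ j = 0 := by omega
    rw [coeff_deltaDeltaSeries, coeff_log_subst hQ _ le_rfl, logTrunc, map_sum]
    refine Eq.trans ?_ (sum_eq_zero fun m hm => ?_).symm
    · rcases hij' with rfl | rfl <;> simp [opDelta_zero]
    · obtain ⟨k, rfl⟩ : ∃ k, m = k + 1 := ⟨m - 1, by have := (mem_Icc.1 hm).1; omega⟩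
      rw [coeff_complex_smul, pow_succ, coeff_mul_pairSeries_eq_zero _ _ hij', smul_zero]

end Fay

end FrobeniusKP

end

theorem mainTheorem2 :
    (∀ N : ℕ, 1 ≤ N → ∃ F : MvPolynomial (Fin N) ℂ, FrobeniusKP.IsPotentialA N F) ∧
    ∀ F : (∀ N : ℕ, MvPolynomial (Fin N) ℂ),
      (∀ N : ℕ, 1 ≤ N → FrobeniusKP.IsPotentialA N (F N)) →
      ∀ (K : Type*) [CommRing K] [Algebra ℂ K],
        (∀ (f : MvPowerSeries ℕ+ K) (α β : ℕ+),
          (FrobeniusKP.EquationA F (FrobeniusKP.partialD K) α β (FrobeniusKP.changeVars f) ↔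
            FrobeniusKP.EquationARescaled F (FrobeniusKP.partialD K) α β f) ∧
          (FrobeniusKP.EquationA F (FrobeniusKP.partialD K) α β (FrobeniusKP.changeVars f) ↔
            FrobeniusKP.EquationDKP α β f)) ∧
        (∀ (h : K) (f : MvPowerSeries ℕ+ K),
          FrobeniusKP.IsKPSolution h f ↔
            ∀ α β : ℕ+, FrobeniusKP.EquationARescaled F (FrobeniusKP.partialH h) α β f) := by
  refine ⟨fun N hN => FrobeniusKP.exists_isPotentialA hN, fun F hF K _ _ =>
    ⟨fun f α β => ?_, fun h f => FrobeniusKP.isKPSolution_iff hF h f⟩⟩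
  have h1 := FrobeniusKP.equationA_changeVars_iff F α β f
  exact ⟨h1, h1.trans (FrobeniusKP.equationARescaled_iff_equationDKP hF α β f)⟩
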